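/- **Setting.** All vector spaces are real. Let $X$ be a Banach space, $\Omega\subset X$ open, and $Y$ a vector space. For each $x\in\Omega$ let $Q(x,\cdot)$ be a quadratic form on $Y$ and $G(x,\cdot)$ a quadratic form whose domain is a linear subspace $H(x)\subset Y$ ($G(x,\cdot)=+\infty$ off $H(x)$). Let $B(x,\cdot,\cdot)$ and $\Gamma(x,\cdot,\cdot)$ be the associated symmetric bilinear forms and $\mathcal R(x,u)=G(x,u)/Q(x,u)$ for $u\neq 0$. A subscript $x$ denotes the Fréchet derivative in the parameter (an element of $X^*$, with its norm topology). Assume that at every $x\in\Omega$: * (A) $Q(x,\cdot)$ is positive definite on $Y$ and $H(x)$ is $Q^{1/2}(x,\cdot)$-dense in $Y$. * There is a function $\theta$ (which may depend on $x$), positive and bounded on a neighborhood of $x$ in $\Omega$, such that, with $N(x',u):=\big(G(x',u)+\theta(x')Q(x',u)\big)^{1/2}$ (and $N(x',u)=+\infty$ for $u\notin H(x')$), the following (B), (C), (D), (F), (G) hold. * (B) For $x'$ in a neighborhood of $x$, $N(x',\cdot)$ is a Hilbert norm on $H(x')$, i.e. $G(x',\cdot)+\theta(x')Q(x',\cdot)$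 is positive definite on $H(x')$, and $H(x')$ is complete for $N(x',\cdot)$. * (C) There is $C\ge1$ with $C^{-1}N(x',\cdot)\le N(x,\cdot)\le C\,N(x',\cdot)$ for all $x'$ in a neighborhood of $x$; in particular $H(x')=H(x)=:H$ there. * (D) If $x_n\in\Omega$, $x_n\to x$, $u_n\in H$ and $\sup_n N(x_n,u_n)<\infty$, then there is $u\in H$ such that, along a common subsequence, $Q(x_n,u_n-u)\to0$ and $\Gamma(x_n,u_n,v)\to\Gamma(x,u,v)$ for all $v\in H$. * (E) $Q(\cdot,u)$ and $G(\cdot,v)$ are Fréchet differentiable at $x$ for all $u\in Y$, $v\in H$. * (F) Let $x_n\in\Omega$, $x_n\to x$. If $u_n,u\in Y$ and $Q(x_n,u_n-u)\to0$, then $Q(x_n,u_n)\to Q(x,u)$ and $Q_x(x_n,u_n)\to Q_x(x,u)$. If $v_n,v\in H$ and $N(x_n,v_n-v)\to0$, then $G(x_n,v_n)\to G(x,v)$ and $G_x(x_n,v_n)\to G_x(x,v)$. * (G) There is $C_0>0$ such that for all $x'$ in a neighborhood of $x$ and all $v_1,v_2\in H$, both $\|B_x(x',v_1,v_2)\|_{X^*}$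 and $\|\Gamma_x(x',v_1,v_2)\|_{X^*}$ are at most $C_0N(x',v_1)N(x',v_2)$. For a vector space $E$ let $\mathcal G_k(E)$ be the set of its $k$-dimensional subspaces. For $1\le k\le\dim H(x)$ set $$\lambda_k(x)=\min_{E\in\mathcal G_k(H(x))}\ \max_{u\in E,\,Q(x,u)=1}\mathcal R(x,u),$$ $$E_k(x)=\{u\in H(x):\ \Gamma(x,u,v)=\lambda_k(x)B(x,u,v)\ \ \forall v\in H(x)\}.$$ Let $m$ be the number, and $j_*$ the smallest, of the indices $1\le j\le\dim H(x)$ such that $\lambda_j(x)=\lambda_k(x)$, and let $p_k(x)=k-j_*+1$. For $h\in X$ and $u,v\in E_k(x)$ let $\mathcal B(u,v)=\langle\Gamma_x(x,u,v)-\lambda_k(x)B_x(x,u,v),h\rangle$. **Theorem.** Let $x\in\Omega$, $h\in X$, and let $k\ge1$ with $k\le\dim H(x)$ (no restriction if $H(x)$ is infinite dimensional). 1. For any $t_n>0$ with $t_n\to0$ and any $z_n\in X$ with $z_n=o(t_n)$, there are a subsequence, still indexed by $n$, and a family $u_1,\dots,u_m\in E_k(x)$ that is $Q(x,\cdot)$-orthonormal,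 $G(x,\cdot)$-orthogonal and $\mathcal B$-orthogonal, such that for every $j\in\{1,\dots,m\}$ $$\lim_{n\to\infty}\frac{\lambda_{j_*+j-1}(x+t_nh+z_n)-\lambda_{j_*+j-1}(x)}{t_n}=\langle\mathcal R_x(x,u_j),h\rangle.$$ 2. For every curve $y$ in $X$, defined near $0\in\mathbb R$, with $y(0)=x$, differentiable at $0$ with $y'(0)=h$, $$\lim_{t\downarrow0}\frac{\lambda_k(y(t))-\lambda_k(x)}{t}=\min_{F\in\mathcal G_{p_k(x)}(E_k(x))}\ \max_{u\in F\setminus\{0\}}\langle\mathcal R_x(x,u),h\rangle,$$ where the maxima and the minimum are attained. In particular $\lambda_k$ has a right derivative at $x$ in the direction $h$, namely $\lim_{t\downarrow0}\big(\lambda_k(x+th)-\lambda_k(x)\big)/t$, and it equals the same min-max. -/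

import Mathlib

open Filter Topology Asymptotics

noncomputable section

/-- The data of a parameter-dependent Rayleigh quotient: an open parameter set `Ω` in `X` (openness
is required in `StandingAssumptions` below), for every parameter `x` a quadratic form `Q x` on `Y`,
and a quadratic form `G x` with domain the linear subspace `H x` of `Y` (so that `G x` is
thought of as `+∞` off `H x`). Only the parameters in `Ω` matter. -/
structure RayleighFamily (X Y : Type*) [NormedAddCommGroup X] [NormedSpace ℝ X]
    [AddCommGroup Y] [Module ℝ Y] where
  Ω : Set X
  Q : X → QuadraticForm ℝ Y
  H : X → Submodule ℝ Y
  G : (x : X) → QuadraticForm ℝ (H x)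

/-- A quadratic form `P` on `E` is the square of a Hilbert norm: it is positive definite and
`E` is complete for the norm `P ^ (1/2)`. -/
def IsHilbertForm {E : Type*} [AddCommGroup E] [Module ℝ E] (P : QuadraticForm ℝ E) : Prop :=
  P.PosDef ∧
    ∀ u : ℕ → E, (∀ ε : ℝ, 0 < ε → ∃ n₀ : ℕ, ∀ m ≥ n₀, ∀ n ≥ n₀, P (u m - u n) < ε) →
      ∃ v : E, Tendsto (fun n => P (u n - v)) atTop (𝓝 0)

/-- The set of `k`-dimensional linear subspaces of `E` (used for `k ≥ 1` only). -/
def grassmannian {Y : Type*} [AddCommGroup Y] [Module ℝ Y] (k : ℕ) (E : Submodule ℝ Y) :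
    Set (Submodule ℝ Y) :=
  {F | F ≤ E ∧ Module.finrank ℝ F = k}

/-- `ℓ = min_{F ∈ 𝓕} max_{u ∈ F \ {0}} f u`, where all the maxima and the minimum are attained. -/
def IsMinMax {Y : Type*} [AddCommGroup Y] [Module ℝ Y] (𝓕 : Set (Submodule ℝ Y)) (f : Y → ℝ)
    (ℓ : ℝ) : Prop :=
  (∀ F ∈ 𝓕, ∃ M : ℝ, IsGreatest (f '' {u | u ∈ F ∧ u ≠ 0}) M) ∧
    IsLeast {M : ℝ | ∃ F ∈ 𝓕, IsGreatest (f '' {u | u ∈ F ∧ u ≠ 0}) M} ℓ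

/-- `φ` has right derivative `ℓ` at `x` in the direction `h`. -/
def HasRightDirDeriv {X : Type*} [NormedAddCommGroup X] [NormedSpace ℝ X] (φ : X → ℝ) (x h : X)
    (ℓ : ℝ) : Prop :=
  Tendsto (fun t : ℝ => (φ (x + t • h) - φ x) / t) (𝓝[>] 0) (𝓝 ℓ)

namespace RayleighFamily

variable {X Y : Type*} [NormedAddCommGroup X] [NormedSpace ℝ X] [AddCommGroup Y] [Module ℝ Y]

/-- The symmetric bilinear form associated with `Q x`. -/
def B (S : RayleighFamily X Y) (x : X) (u v : Y) : ℝ :=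
  QuadraticMap.associated (R := ℝ) (S.Q x) u v

open Classical in
/-- The value `G(x,u)` for `u` in the domain `H x`; the value `0` off the domain is never used. -/
def g (S : RayleighFamily X Y) (x : X) (u : Y) : ℝ :=
  if hu : u ∈ S.H x then S.G x ⟨u, hu⟩ else 0

/-- The symmetric bilinear form associated with `G x`, for `u` and `v` in `H x`. -/
def Γ (S : RayleighFamily X Y) (x : X) (u v : Y) : ℝ :=
  (S.g x (u + v) - S.g x u - S.g x v) / 2

/-- The Rayleigh quotient `R(x,u) = G(x,u) / Q(x,u)` for nonzero `u` in `H x` (off `H x` the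
quotient is `+∞`; it is never evaluated there). -/
def rayleigh (S : RayleighFamily X Y) (x : X) (u : Y) : ℝ :=
  S.g x u / S.Q x u

/-- The form `G x + c Q x` on `H x`. -/
def shiftedForm (S : RayleighFamily X Y) (c : ℝ) (x : X) : QuadraticForm ℝ (S.H x) :=
  S.G x + c • (S.Q x).comp (S.H x).subtype

/-- `N(x,u) = (G(x,u) + θ(x) Q(x,u)) ^ (1/2)`, for `u` in `H x`. -/
def N (S : RayleighFamily X Y) (θ : X → ℝ) (x : X) (u : Y) : ℝ :=
  Real.sqrt (S.g x u + θ x * S.Q x u)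

/-! Fréchet derivatives with respect to the parameter. -/

def Qx (S : RayleighFamily X Y) (x : X) (u : Y) : X →L[ℝ] ℝ := fderiv ℝ (fun y => S.Q y u) x

def Gx (S : RayleighFamily X Y) (x : X) (u : Y) : X →L[ℝ] ℝ := fderiv ℝ (fun y => S.g y u) x

def Bx (S : RayleighFamily X Y) (x : X) (u v : Y) : X →L[ℝ] ℝ := fderiv ℝ (fun y => S.B y u v) x

def Γx (S : RayleighFamily X Y) (x : X) (u v : Y) : X →L[ℝ] ℝ := fderiv ℝ (fun y => S.Γ y u v) x

def rayleighx (S : RayleighFamily X Y) (x : X) (u : Y) : X →L[ℝ] ℝ :=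
  fderiv ℝ (fun y => S.rayleigh y u) x

/-! The standing assumptions at a parameter `x`. -/

/-- `Q x` is positive definite and the domain of `G x` is dense for the norm `Q(x,·) ^ (1/2)`. -/
def FormsAt (S : RayleighFamily X Y) (x : X) : Prop :=
  (S.Q x).PosDef ∧
    ∀ u : Y, ∃ v : ℕ → Y, (∀ i, v i ∈ S.H x) ∧ Tendsto (fun i => S.Q x (u - v i)) atTop (𝓝 0)

/-- On a neighborhood of `x` the function `θ` is positive and bounded, and `N(x',·)` is a
Hilbert norm on `H x'`. -/
def HilbertAt (S : RayleighFamily X Y) (θ : X → ℝ) (x : X) : Prop :=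
  ∃ V ∈ 𝓝 x, V ⊆ S.Ω ∧ (∃ M : ℝ, ∀ x' ∈ V, θ x' ≤ M) ∧
    ∀ x' ∈ V, 0 < θ x' ∧ IsHilbertForm (S.shiftedForm (θ x') x')

/-- The norms `N(x',·)` (equal to `+∞` off `H x'`) are uniformly equivalent to `N(x,·)` for `x'`
in a neighborhood of `x`; in particular they have the same domain. -/
def NormsEquivalentAt (S : RayleighFamily X Y) (θ : X → ℝ) (x : X) : Prop :=
  ∃ C : ℝ, 1 ≤ C ∧ ∃ V ∈ 𝓝 x, V ⊆ S.Ω ∧ ∀ x' ∈ V, S.H x' = S.H x ∧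
    ∀ u ∈ S.H x, C⁻¹ * S.N θ x' u ≤ S.N θ x u ∧ S.N θ x u ≤ C * S.N θ x' u

/-- The compactness assumption. -/
def CompactAt (S : RayleighFamily X Y) (θ : X → ℝ) (x : X) : Prop :=
  ∀ (xs : ℕ → X) (us : ℕ → Y), (∀ n, xs n ∈ S.Ω) → Tendsto xs atTop (𝓝 x) →
    (∀ n, us n ∈ S.H x) → (∃ M : ℝ, ∀ n, S.N θ (xs n) (us n) ≤ M) →
    ∃ u ∈ S.H x, ∃ φ : ℕ → ℕ, StrictMono φ ∧
      Tendsto (fun n => S.Q (xs (φ n)) (us (φ n) - u)) atTop (𝓝 0) ∧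
      ∀ v ∈ S.H x, Tendsto (fun n => S.Γ (xs (φ n)) (us (φ n)) v) atTop (𝓝 (S.Γ x u v))

/-- Fréchet differentiability of the forms at `x`. -/
def DifferentiableFormsAt (S : RayleighFamily X Y) (x : X) : Prop :=
  (∀ u : Y, DifferentiableAt ℝ (fun y => S.Q y u) x) ∧
    ∀ v ∈ S.H x, DifferentiableAt ℝ (fun y => S.g y v) x

/-- Joint continuity at `x` of `Q` and of its derivative along `Q`-convergent sequences, and of
`G` and of its derivative along `N`-convergent sequences. -/
def ContinuousFormsAt (S : RayleighFamily X Y) (θ : X → ℝ) (x : X) : Prop :=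
  (∀ (xs : ℕ → X) (us : ℕ → Y) (u : Y), (∀ n, xs n ∈ S.Ω) → Tendsto xs atTop (𝓝 x) →
    Tendsto (fun n => S.Q (xs n) (us n - u)) atTop (𝓝 0) →
      Tendsto (fun n => S.Q (xs n) (us n)) atTop (𝓝 (S.Q x u)) ∧
      Tendsto (fun n => S.Qx (xs n) (us n)) atTop (𝓝 (S.Qx x u))) ∧
  ∀ (xs : ℕ → X) (vs : ℕ → Y) (v : Y), (∀ n, xs n ∈ S.Ω) → Tendsto xs atTop (𝓝 x) →
    (∀ n, vs n ∈ S.H x) → v ∈ S.H x →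
    Tendsto (fun n => S.N θ (xs n) (vs n - v)) atTop (𝓝 0) →
      Tendsto (fun n => S.g (xs n) (vs n)) atTop (𝓝 (S.g x v)) ∧
      Tendsto (fun n => S.Gx (xs n) (vs n)) atTop (𝓝 (S.Gx x v))

/-- Local bounds for the derivatives of the bilinear forms. The bound for `Bx` is vacuous for
vectors off `H x`, where `N = +∞`. -/
def DerivBoundsAt (S : RayleighFamily X Y) (θ : X → ℝ) (x : X) : Prop :=
  ∃ C₀ : ℝ, 0 < C₀ ∧ ∃ V ∈ 𝓝 x, V ⊆ S.Ω ∧ ∀ x' ∈ V, ∀ u ∈ S.H x, ∀ v ∈ S.H x,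
    ‖S.Bx x' u v‖ ≤ C₀ * S.N θ x' u * S.N θ x' v ∧
    ‖S.Γx x' u v‖ ≤ C₀ * S.N θ x' u * S.N θ x' v

/-- All the standing assumptions, at every parameter of the open set `Ω`. The shift `θ` is only
given near each parameter and may depend on it. -/
structure StandingAssumptions (S : RayleighFamily X Y) : Prop where
  isOpen : IsOpen S.Ω
  forms : ∀ x ∈ S.Ω, S.FormsAt x
  differentiable : ∀ x ∈ S.Ω, S.DifferentiableFormsAt x
  shift : ∀ x ∈ S.Ω, ∃ θ : X → ℝ, S.HilbertAt θ x ∧ S.NormsEquivalentAt θ x ∧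
    S.CompactAt θ x ∧ S.ContinuousFormsAt θ x ∧ S.DerivBoundsAt θ x

/-! Eigenvalues and eigenspaces. -/

/-- `λ_k(x)`: minimum over the `k`-dimensional subspaces `E` of `H x` of the maximum of the
Rayleigh quotient over the `Q x`-unit sphere of `E`. -/
def eigenvalue (S : RayleighFamily X Y) (k : ℕ) (x : X) : ℝ :=
  sInf ((fun E : Submodule ℝ Y => sSup (S.rayleigh x '' {u | u ∈ E ∧ S.Q x u = 1})) ''
    grassmannian k (S.H x))

/-- `L(x) u = w` for the operator `L(x)` of the form `G x` with respect to the scalar product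
`B x`; such a `w` is unique, by density of `H x`. -/
def OperatorRel (S : RayleighFamily X Y) (x : X) (u w : Y) : Prop :=
  u ∈ S.H x ∧ ∀ v ∈ S.H x, S.Γ x u v = S.B x w v

theorem Γ_eq (S : RayleighFamily X Y) (x : X) {u v : Y} (hu : u ∈ S.H x) (hv : v ∈ S.H x) :
    S.Γ x u v = QuadraticMap.associated (R := ℝ) (S.G x) ⟨u, hu⟩ ⟨v, hv⟩ := by
  have huv : u + v ∈ S.H x := add_mem hu hv
  simp only [Γ, g, hu, hv, huv, dif_pos, QuadraticMap.associated_apply, AddMemClass.mk_add_mk]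
  rw [Module.End.smul_def]
  simp
  ring

/-- The eigenspace `E_k(x) = {u ∈ H x : L(x) u = λ_k(x) u}`. -/
def eigenspace (S : RayleighFamily X Y) (k : ℕ) (x : X) : Submodule ℝ Y where
  carrier := {u | S.OperatorRel x u (S.eigenvalue k x • u)}
  zero_mem' := by
    refine ⟨zero_mem _, fun v hv => ?_⟩
    rw [S.Γ_eq x (zero_mem _) hv]
    have h0 : (⟨0, zero_mem _⟩ : S.H x) = 0 := rfl
    rw [h0, smul_zero, B]
    simp
  add_mem' := by
    rintro a b ⟨ha, ha'⟩ ⟨hb, hb'⟩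
    refine ⟨add_mem ha hb, fun v hv => ?_⟩
    have h1 := ha' v hv
    have h2 := hb' v hv
    rw [S.Γ_eq x ha hv] at h1
    rw [S.Γ_eq x hb hv] at h2
    rw [S.Γ_eq x (add_mem ha hb) hv]
    have h0 : (⟨a + b, add_mem ha hb⟩ : S.H x) = ⟨a, ha⟩ + ⟨b, hb⟩ := rfl
    rw [h0, map_add, LinearMap.add_apply, h1, h2, smul_add]
    simp only [B, map_add, LinearMap.add_apply]
  smul_mem' := by
    rintro c a ⟨ha, ha'⟩
    refine ⟨Submodule.smul_mem _ c ha, fun v hv => ?_⟩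
    have h1 := ha' v hv
    rw [S.Γ_eq x ha hv] at h1
    rw [S.Γ_eq x (Submodule.smul_mem _ c ha) hv]
    have h0 : (⟨c • a, Submodule.smul_mem _ c ha⟩ : S.H x) = c • ⟨a, ha⟩ := rfl
    rw [h0, map_smul, LinearMap.smul_apply, h1, smul_comm]
    simp only [B, map_smul, LinearMap.smul_apply]

/-- The set of indices `j ≥ 1` with `λ_j(x) = λ_k(x)`. The condition that `H x` has a
`j`-dimensional subspace, i.e. that `λ_j(x)` exists, holds for all `j` if `H x` is infinite
dimensional. -/
def cluster (S : RayleighFamily X Y) (k : ℕ) (x : X) : Set ℕ :=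
  {j | 1 ≤ j ∧ (grassmannian j (S.H x)).Nonempty ∧ S.eigenvalue j x = S.eigenvalue k x}

/-- The multiplicity of `λ_k(x)`. -/
def multiplicity (S : RayleighFamily X Y) (k : ℕ) (x : X) : ℕ := (S.cluster k x).ncard

/-- The lowest index `j` with `λ_j(x) = λ_k(x)`. -/
def firstIndex (S : RayleighFamily X Y) (k : ℕ) (x : X) : ℕ := sInf (S.cluster k x)

/-- The position `p_k(x)` of `k` among the indices `j` with `λ_j(x) = λ_k(x)`. -/
def position (S : RayleighFamily X Y) (k : ℕ) (x : X) : ℕ := k - S.firstIndex k x + 1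

/-- The bilinear form `(u, v) ↦ ⟨Γx(x,u,v) - λ_k(x) Bx(x,u,v), h⟩`. -/
def derivForm (S : RayleighFamily X Y) (k : ℕ) (x h : X) (u v : Y) : ℝ :=
  (S.Γx x u v - S.eigenvalue k x • S.Bx x u v) h

end RayleighFamily

end

/-!
On the form domain `H` at `x` write `q = G - λ Q` with `λ = λ_k(x)`, and let `N = G + θ Q` be the
square of the Hilbert norm. No spectral theorem in infinite dimension is needed. A maximal subspace
`V` on which `q` is negative definite and the kernel `E` of `q` are finite-dimensional by
compactness, and `q ≥ δ N` on the vectors that are `q`-orthogonal to `V` and `Q`-orthogonal to `E`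
(`IsCompactPair.exists_isSplitting`). Testing the min-max on these spaces shows that the indices of
the cluster of `λ` are `dim V + 1, …, dim V + dim E` and that `E` is the eigenspace
(`RayleighFamily.StandingAssumptions.cluster_eq`, `RayleighFamily.map_kernel_eq_eigenspace`).

For parameters `x_i = x + t_i h + o(t_i)`, the mean value inequality and the bounds on the
derivatives give forms `Q_i`, `G_i` with `Q_i - Q = O(t_i)` and `G_i - G = O(t_i)` with respect to
`N`, while on `E` the form `(G_i - λ Q_i) / t_i` converges to the derivative form `D`. In
`P_i = G_i - (λ + t_i c) Q_i`, evaluated at `e + w` with `e` in `E` and `w` in the uniformly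
definite part, the term in `e` is of order `t_i |e|²`, the cross term is `O(t_i |e| |w|)` because
`q(e, ·) = 0`, and the term in `w` is of order `|w|²`; so the sign of `P_i` is that of `D - c Q` on
`E` as soon as this agrees with the sign of `q` on the `w`
(`eventually_perturbed_form_nonneg`). Let `e_1, …, e_m` be a `Q`-orthonormal basis of `E` that
diagonalizes `D` with increasing values `ρ_j = D(e_j, e_j)`. The upper test space
`V + span(e_1, …, e_j)` and the vectors orthogonal to `V` and `e_1, …, e_{j-1}` in an arbitrary test
space then squeeze the eigenvalue of index `dim V + j` between `λ + t_i (ρ_j - ε)` and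
`λ + t_i (ρ_j + ε)`. Hence the whole family of difference quotients converges to `ρ_j`, without
passing to subsequences, and `ρ_j` is the value at `e_j` of the derivative of the Rayleigh quotient
(`RayleighFamily.rayleighx_eq`). The min-max formula is Courant–Fischer for `D` on `E`.
-/

/-! ### Symmetric bilinear forms on finite-dimensional spaces -/

section FormAlgebra

open LinearMap (BilinForm)

variable {E : Type*} [AddCommGroup E] [Module ℝ E]

/-- The scalar product given by a positive definite symmetric bilinear form. -/
abbrev innerCoreOfForm (B : BilinForm ℝ E) (hB : ∀ u v, B u v = B v u)
    (hpos : ∀ u, u ≠ 0 → 0 < B u u) : InnerProductSpace.Core ℝ E where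
  inner u v := B u v
  conj_inner_symm u v := by simpa using hB v u
  re_inner_nonneg u := by
    rcases eq_or_ne u 0 with rfl | hu
    · simp
    · simpa using (hpos u hu).le
  add_left u v w := by simp
  smul_left u v r := by simp
  definite u hu := by
    by_contra h
    exact (hpos u h).ne' hu

theorem nondegenerate_of_posDef (B : BilinForm ℝ E) (hpos : ∀ u, u ≠ 0 → 0 < B u u) :
    B.Nondegenerate :=
  ⟨fun u hu => by_contra fun h => (hpos u h).ne' (hu u),
    fun u hu => by_contra fun h => (hpos u h).ne' (hu u)⟩

/-- Simultaneous diagonalization of two symmetric forms, one of them positive definite, with the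
eigenvalues in increasing order. -/
theorem exists_diagonalizing_basis [FiniteDimensional ℝ E] {n : ℕ}
    (hn : Module.finrank ℝ E = n) (B b : BilinForm ℝ E) (hB : ∀ u v, B u v = B v u)
    (hpos : ∀ u, u ≠ 0 → 0 < B u u) (hb : ∀ u v, b u v = b v u) :
    ∃ e : Module.Basis (Fin n) ℝ E, (∀ i j, B (e i) (e j) = if i = j then 1 else 0) ∧
      (∀ i j, i ≠ j → b (e i) (e j) = 0) ∧ Monotone fun i => b (e i) (e i) := by
  let core := innerCoreOfForm B hB hpos
  let : NormedAddCommGroup E := core.toNormedAddCommGroup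
  let : InnerProductSpace ℝ E := InnerProductSpace.ofCore core.toCore
  have hinner : ∀ u v : E, inner ℝ u v = B u v := fun _ _ => rfl
  have hnd := nondegenerate_of_posDef B hpos
  -- The sign turns the decreasing order of `LinearMap.IsSymmetric.eigenvalues` into an
  -- increasing one.
  let T : E →ₗ[ℝ] E := -((B.toDual hnd).symm.toLinearMap ∘ₗ b)
  have hT : ∀ u v, B (T u) v = -b u v := by
    intro u v
    have h1 : B ((B.toDual hnd).symm (b u)) v = b u v := by
      rw [← LinearMap.BilinForm.toDual_def hnd, LinearEquiv.apply_symm_apply]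
    simp [T, h1]
  have hsym : T.IsSymmetric := by
    intro u v
    rw [hinner, hinner, hT, hB u, hT, hb]
  have hbe : ∀ i j, b (hsym.eigenvectorBasis hn i) (hsym.eigenvectorBasis hn j) =
      if i = j then -hsym.eigenvalues hn i else 0 := by
    intro i j
    have h1 := hT (hsym.eigenvectorBasis hn i) (hsym.eigenvectorBasis hn j)
    rw [hsym.apply_eigenvectorBasis] at h1
    have h2 := (orthonormal_iff_ite.1 (hsym.eigenvectorBasis hn).orthonormal) i j
    rw [hinner] at h2
    simp only [map_smul, LinearMap.smul_apply, h2, RCLike.ofReal_real_eq_id, id,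
      smul_eq_mul] at h1
    split_ifs at h1 ⊢ <;> linarith
  refine ⟨(hsym.eigenvectorBasis hn).toBasis, fun i j => ?_, fun i j hij => ?_, fun i j hij => ?_⟩
  · have h2 := (orthonormal_iff_ite.1 (hsym.eigenvectorBasis hn).orthonormal) i j
    rw [hinner] at h2
    simpa using h2
  · simp [hbe, hij]
  · simpa [hbe] using hsym.eigenvalues_antitone hn hij

/-- The value of a form in a basis that diagonalizes it. -/
theorem form_apply_of_diagonal {n : ℕ} (e : Module.Basis (Fin n) ℝ E) (b : BilinForm ℝ E)
    (hb : ∀ i j, i ≠ j → b (e i) (e j) = 0) (u v : E) :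
    b u v = ∑ i, b (e i) (e i) * (e.repr u i * e.repr v i) := by
  conv_lhs => rw [← e.sum_repr u, ← e.sum_repr v]
  simp only [map_sum, LinearMap.sum_apply, map_smul, LinearMap.smul_apply, smul_eq_mul]
  refine Finset.sum_congr rfl fun i _ => ?_
  rw [Finset.sum_eq_single i]
  · ring
  · intro j _ hj
    simp [hb j i hj]
  · simp

/-- A subspace of dimension greater than `p` meets the common kernel of `p` linear forms. -/
theorem exists_ne_zero_mem_ker {G : Type*} [AddCommGroup G] [Module ℝ G] [FiniteDimensional ℝ G]
    (F : Submodule ℝ E) [FiniteDimensional ℝ F] (f : E →ₗ[ℝ] G)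
    (h : Module.finrank ℝ G < Module.finrank ℝ F) : ∃ u ∈ F, u ≠ 0 ∧ f u = 0 := by
  have h1 := LinearMap.ker_ne_bot_of_finrank_lt (f := f ∘ₗ F.subtype) h
  obtain ⟨u, hu, hu0⟩ := Submodule.exists_mem_ne_zero_of_ne_bot h1
  exact ⟨u, u.2, by simpa using hu0, by simpa using hu⟩

/-- The span of the first `p` vectors of a basis. -/
def initialSpan {n : ℕ} (e : Module.Basis (Fin n) ℝ E) {p : ℕ} (hp : p ≤ n) : Submodule ℝ E :=
  Submodule.span ℝ (Set.range fun i : Fin p => e (Fin.castLE hp i))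

theorem finrank_initialSpan {n : ℕ} (e : Module.Basis (Fin n) ℝ E) {p : ℕ} (hp : p ≤ n) :
    Module.finrank ℝ (initialSpan e hp) = p := by
  have := finrank_span_eq_card (R := ℝ) (b := fun i : Fin p => e (Fin.castLE hp i))
    (e.linearIndependent.comp _ (Fin.castLE_injective hp))
  exact this.trans (Fintype.card_fin p)

theorem repr_eq_zero_of_mem_initialSpan {n : ℕ} (e : Module.Basis (Fin n) ℝ E) {p : ℕ}
    (hp : p ≤ n) {u : E} (hu : u ∈ initialSpan e hp) {i : Fin n} (hi : p ≤ i) :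
    e.repr u i = 0 := by
  have h : initialSpan e hp ≤ LinearMap.ker (e.coord i) := by
    refine Submodule.span_le.2 ?_
    rintro _ ⟨j, rfl⟩
    have hji : Fin.castLE hp j ≠ i := by
      intro h
      have := congrArg Fin.val h
      simp at this
      omega
    simp [hji]
  simpa using h hu

variable {n : ℕ} (e : Module.Basis (Fin n) ℝ E) (B b : BilinForm ℝ E)

theorem form_eq_sum_sq (hBe : ∀ i j, B (e i) (e j) = if i = j then 1 else 0) (u : E) :
    B u u = ∑ i, e.repr u i ^ 2 := by
  rw [form_apply_of_diagonal e B (fun i j hij => by simp [hBe, hij])]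
  exact Finset.sum_congr rfl fun i _ => by simp [hBe, sq]

theorem form_le_of_mem_initialSpan (hBe : ∀ i j, B (e i) (e j) = if i = j then 1 else 0)
    (hbe : ∀ i j, i ≠ j → b (e i) (e j) = 0) (hmono : Monotone fun i => b (e i) (e i))
    (p : Fin n) {u : E} (hu : u ∈ initialSpan e (p := p + 1) p.2) :
    b u u ≤ b (e p) (e p) * B u u := by
  rw [form_apply_of_diagonal e b hbe u u, form_eq_sum_sq e B hBe, Finset.mul_sum]
  refine Finset.sum_le_sum fun i _ => ?_
  rcases le_or_gt i p with hi | hi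
  · rw [← sq]
    exact mul_le_mul_of_nonneg_right (hmono hi) (sq_nonneg _)
  · simp [repr_eq_zero_of_mem_initialSpan e (p := p + 1) p.2 hu (i := i) hi]

theorem form_ge_of_repr_eq_zero (hBe : ∀ i j, B (e i) (e j) = if i = j then 1 else 0)
    (hbe : ∀ i j, i ≠ j → b (e i) (e j) = 0) (hmono : Monotone fun i => b (e i) (e i))
    (p : Fin n) {u : E} (hu : ∀ i < p, e.repr u i = 0) :
    b (e p) (e p) * B u u ≤ b u u := by
  rw [form_apply_of_diagonal e b hbe u u, form_eq_sum_sq e B hBe, Finset.mul_sum]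
  refine Finset.sum_le_sum fun i _ => ?_
  rcases le_or_gt p i with hi | hi
  · rw [← sq]
    exact mul_le_mul_of_nonneg_right (hmono hi) (sq_nonneg _)
  · simp [hu i hi]

/-- The Rayleigh quotient of two forms on a finite-dimensional space attains its maximum. -/
theorem exists_isGreatest_rayleigh [FiniteDimensional ℝ E] (hE : 0 < Module.finrank ℝ E)
    (hB : ∀ u v, B u v = B v u) (hpos : ∀ u, u ≠ 0 → 0 < B u u) (hb : ∀ u v, b u v = b v u) :
    ∃ u, u ≠ 0 ∧ ∀ v, b v v ≤ b u u / B u u * B v v := by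
  obtain ⟨m, hm⟩ : ∃ m, Module.finrank ℝ E = m + 1 := ⟨_, (Nat.succ_pred_eq_of_pos hE).symm⟩
  obtain ⟨e, h1, h2, h3⟩ := exists_diagonalizing_basis hm B b hB hpos hb
  refine ⟨e (Fin.last m), e.ne_zero _, fun v => ?_⟩
  rw [h1, if_pos rfl, div_one, form_apply_of_diagonal e b h2, form_eq_sum_sq e B h1,
    Finset.mul_sum]
  refine Finset.sum_le_sum fun i _ => ?_
  rw [← sq]
  exact mul_le_mul_of_nonneg_right (h3 (Fin.le_last i)) (sq_nonneg _)

/-- **Courant–Fischer** in finite dimension. -/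
theorem isMinMax_of_diagonalizing_basis
    (hBe : ∀ i j, B (e i) (e j) = if i = j then 1 else 0) (hB : ∀ u v, B u v = B v u)
    (hpos : ∀ u, u ≠ 0 → 0 < B u u) (hb : ∀ u v, b u v = b v u)
    (hbe : ∀ i j, i ≠ j → b (e i) (e j) = 0) (hmono : Monotone fun i => b (e i) (e i))
    (p : Fin n) :
    IsMinMax (grassmannian (p + 1) (⊤ : Submodule ℝ E)) (fun u => b u u / B u u)
      (b (e p) (e p)) := by
  have hfin : FiniteDimensional ℝ E := e.finiteDimensional_of_finite
  refine ⟨fun F hF => ?_, ⟨initialSpan e (p := p + 1) p.2,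
    ⟨le_top, finrank_initialSpan e _⟩, ⟨e p, ⟨Submodule.subset_span ⟨Fin.last p, rfl⟩,
      e.ne_zero p⟩, by simp [hBe]⟩, ?_⟩, ?_⟩
  · obtain ⟨u, hu, hmax⟩ := exists_isGreatest_rayleigh (B.restrict F) (b.restrict F)
      (by rw [hF.2]; omega) (fun u v => hB u v)
      (fun u hu => hpos u (by simpa using hu)) (fun u v => hb u v)
    refine ⟨_, ⟨u, ⟨u.2, by simpa using hu⟩, rfl⟩, ?_⟩
    rintro _ ⟨v, ⟨hvF, hv⟩, rfl⟩
    exact (div_le_iff₀ (hpos v hv)).2 (hmax ⟨v, hvF⟩)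
  · rintro _ ⟨u, ⟨hu, hu0⟩, rfl⟩
    exact (div_le_iff₀ (hpos u hu0)).2 (form_le_of_mem_initialSpan e B b hBe hbe hmono p hu)
  · rintro M ⟨F, hF, hM⟩
    obtain ⟨u, huF, hu0, hu⟩ := exists_ne_zero_mem_ker F
      (LinearMap.pi fun i : Fin p => e.coord (Fin.castLE p.2.le i)) (by rw [hF.2]; simp)
    have h1 : ∀ i < p, e.repr u i = 0 := by
      intro i hi
      simpa using congrFun hu ⟨i, hi⟩
    refine le_trans ?_ (hM.2 ⟨u, ⟨huF, hu0⟩, rfl⟩)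
    exact (le_div_iff₀ (hpos u hu0)).2 (form_ge_of_repr_eq_zero e B b hBe hbe hmono p h1)

/-- Orthogonal projection onto a finite-dimensional subspace on which a form is definite. -/
theorem exists_orthogonal_projection (hB : ∀ u v, B u v = B v u) (F : Submodule ℝ E)
    [FiniteDimensional ℝ F] (hpos : ∀ u ∈ F, u ≠ 0 → 0 < B u u) (u : E) :
    ∃ v ∈ F, ∀ w ∈ F, B w (u - v) = 0 := by
  have hnd := nondegenerate_of_posDef (B.restrict F)
    (fun u hu => hpos u u.2 (by simpa using hu))
  refine ⟨((B.restrict F).toDual hnd).symm (B u ∘ₗ F.subtype), Submodule.coe_mem _,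
    fun w hw => ?_⟩
  have h1 := LinearMap.BilinForm.toDual_def hnd
    (m := ((B.restrict F).toDual hnd).symm (B u ∘ₗ F.subtype)) (n := ⟨w, hw⟩)
  rw [LinearEquiv.apply_symm_apply] at h1
  have h2 : B u w = B (((B.restrict F).toDual hnd).symm (B u ∘ₗ F.subtype) : F) w := h1
  rw [map_sub, hB w u, h2, hB w, sub_self]

/-- Pointwise convergence of forms on a finite-dimensional space to a positive definite form
implies eventual uniform positivity. -/
theorem eventually_form_ge [FiniteDimensional ℝ E] {ι : Type*} {l : Filter ι}
    (P : ι → BilinForm ℝ E) (hB : ∀ u v, B u v = B v u) (hpos : ∀ u, u ≠ 0 → 0 < B u u)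
    (hb : ∀ u v, b u v = b v u)
    (hlim : ∀ u v, Tendsto (fun i => P i u v) l (𝓝 (B u v))) :
    ∃ η : ℝ, 0 < η ∧ ∀ᶠ i in l, ∀ u, η * b u u ≤ P i u u := by
  obtain ⟨m, hm⟩ : ∃ m, Module.finrank ℝ E = m := ⟨_, rfl⟩
  obtain ⟨e, h1, h2, -⟩ := exists_diagonalizing_basis hm B b hB hpos hb
  set M : ℝ := 1 + ∑ i, |b (e i) (e i)|
  have hM0 : 0 < M := by
    have : 0 ≤ ∑ i, |b (e i) (e i)| := Finset.sum_nonneg fun _ _ => abs_nonneg _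
    linarith
  have hbM : ∀ u, b u u ≤ M * ∑ i, e.repr u i ^ 2 := by
    intro u
    rw [form_apply_of_diagonal e b h2, Finset.mul_sum]
    refine Finset.sum_le_sum fun i _ => ?_
    rw [← sq]
    refine mul_le_mul_of_nonneg_right ?_ (sq_nonneg _)
    have h3 : |b (e i) (e i)| ≤ ∑ i, |b (e i) (e i)| :=
      Finset.single_le_sum (f := fun i => |b (e i) (e i)|) (fun _ _ => abs_nonneg _)
        (Finset.mem_univ i)
    linarith [le_abs_self (b (e i) (e i))]
  refine ⟨1 / (2 * M), by positivity, ?_⟩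
  have hε : (0 : ℝ) < 1 / (2 * (m + 1)) := by positivity
  have hev : ∀ᶠ i in l, ∀ a c, |P i (e a) (e c) - B (e a) (e c)| < 1 / (2 * (m + 1)) := by
    refine eventually_all.2 fun a => eventually_all.2 fun c => ?_
    have := (hlim (e a) (e c)).eventually (Metric.ball_mem_nhds _ hε)
    simpa [Real.dist_eq] using this
  filter_upwards [hev] with i hi u
  have hexp : P i u u - B u u = ∑ a, ∑ c,
      (P i (e c) (e a) - B (e c) (e a)) * (e.repr u a * e.repr u c) := by
    have hexp' : ∀ D : BilinForm ℝ E, D u u =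
        ∑ a, ∑ c, D (e c) (e a) * (e.repr u a * e.repr u c) := by
      intro D
      conv_lhs => rw [← e.sum_repr u]
      simp only [map_sum, LinearMap.sum_apply, map_smul, LinearMap.smul_apply, smul_eq_mul]
      refine Finset.sum_congr rfl fun a _ => ?_
      rw [Finset.mul_sum]
      exact Finset.sum_congr rfl fun c _ => by ring
    rw [hexp', hexp' B, ← Finset.sum_sub_distrib]
    refine Finset.sum_congr rfl fun a _ => ?_
    rw [← Finset.sum_sub_distrib]
    exact Finset.sum_congr rfl fun c _ => by ring
  have hbound : |P i u u - B u u| ≤ 1 / (2 * (m + 1)) * (∑ a, |e.repr u a|) ^ 2 := by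
    rw [hexp, sq, Finset.sum_mul_sum, Finset.mul_sum]
    refine (Finset.abs_sum_le_sum_abs _ _).trans (Finset.sum_le_sum fun a _ => ?_)
    rw [Finset.mul_sum]
    refine (Finset.abs_sum_le_sum_abs _ _).trans (Finset.sum_le_sum fun c _ => ?_)
    rw [abs_mul, abs_mul]
    exact mul_le_mul_of_nonneg_right (hi c a).le (by positivity)
  have hcs : (∑ a, |e.repr u a|) ^ 2 ≤ m * ∑ a, e.repr u a ^ 2 := by
    have := sq_sum_le_card_mul_sum_sq (s := Finset.univ) (f := fun a => |e.repr u a|)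
    simpa using this
  set s := ∑ a, e.repr u a ^ 2
  have hs : 0 ≤ s := Finset.sum_nonneg fun _ _ => sq_nonneg _
  have hhalf : |P i u u - B u u| ≤ s / 2 := by
    refine hbound.trans ((mul_le_mul_of_nonneg_left hcs hε.le).trans ?_)
    rw [div_mul_eq_mul_div, one_mul, div_le_div_iff₀ (by positivity) (by norm_num)]
    nlinarith
  have hBu : B u u = s := form_eq_sum_sq e B h1 u
  have h4 : 1 / (2 * M) * b u u ≤ s / 2 := by
    calc 1 / (2 * M) * b u u ≤ 1 / (2 * M) * (M * s) :=
          mul_le_mul_of_nonneg_left (hbM u) (by positivity)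
      _ = s / 2 := by field_simp
  linarith [(abs_le.1 hhalf).1]

end FormAlgebra

/-! ### Splitting a compact pair of forms at a spectral level -/

section Splitting

open LinearMap (BilinForm)

variable {H : Type*} [AddCommGroup H] [Module ℝ H]

/-- A pair of symmetric forms `Q`, `G` with `Q` positive definite such that the form
`N = G + θ Q` is positive definite and `N`-bounded sequences are relatively compact: strongly with
respect to `Q` and weakly with respect to `G`. Completeness for `N` plays no role. -/
structure IsCompactPair (Q G N : BilinForm ℝ H) (θ : ℝ) : Prop where
  symmQ : ∀ u v, Q u v = Q v u
  symmG : ∀ u v, G u v = G v u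
  posQ : ∀ u, u ≠ 0 → 0 < Q u u
  N_eq : ∀ u v, N u v = G u v + θ * Q u v
  posN : ∀ u, u ≠ 0 → 0 < N u u
  compact : ∀ u : ℕ → H, (∃ M : ℝ, ∀ k, N (u k) (u k) ≤ M) →
    ∃ v, ∃ φ : ℕ → ℕ, StrictMono φ ∧
      Tendsto (fun k => Q (u (φ k) - v) (u (φ k) - v)) atTop (𝓝 0) ∧
      ∀ w, Tendsto (fun k => G (u (φ k)) w) atTop (𝓝 (G v w))

/-- The space splits at the level `lam` of the pair `Q`, `G`: with `q = G - lam Q`, the form `q` is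
uniformly negative on the finite-dimensional space `V`, its kernel `E` is finite-dimensional, and
`q` is uniformly positive on the vectors `q`-orthogonal to `V` and `Q`-orthogonal to `E`. -/
structure IsSplitting (Q G N : BilinForm ℝ H) (lam : ℝ) (V E : Submodule ℝ H) (δ : ℝ) : Prop where
  finV : FiniteDimensional ℝ V
  finE : FiniteDimensional ℝ E
  pos : 0 < δ
  neg_on : ∀ v ∈ V, G v v - lam * Q v v ≤ -(δ * N v v)
  mem_iff : ∀ e, e ∈ E ↔ ∀ u, G e u = lam * Q e u
  pos_on : ∀ w, (∀ v ∈ V, G v w = lam * Q v w) → (∀ e ∈ E, Q e w = 0) →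
    δ * N w w ≤ G w w - lam * Q w w

theorem form_nonneg {Q : BilinForm ℝ H} (hQ : ∀ u, u ≠ 0 → 0 < Q u u) (u : H) : 0 ≤ Q u u := by
  rcases eq_or_ne u 0 with rfl | hu
  · simp
  · exact (hQ u hu).le

theorem form_add_le {Q : BilinForm ℝ H} (hQ : ∀ u, 0 ≤ Q u u) (u v : H) :
    Q (u + v) (u + v) ≤ 2 * Q u u + 2 * Q v v := by
  have h := hQ (u - v)
  simp only [map_add, map_sub, LinearMap.add_apply, LinearMap.sub_apply] at h ⊢
  linarith

theorem form_cauchySchwarz {Q : BilinForm ℝ H} (hs : ∀ u v, Q u v = Q v u)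
    (hQ : ∀ u, 0 ≤ Q u u) (u v : H) : |Q u v| ≤ √(Q u u) * √(Q v v) := by
  rw [← Real.sqrt_mul (hQ u)]
  refine Real.abs_le_sqrt ?_
  have := LinearMap.BilinForm.apply_mul_apply_le_of_forall_zero_le Q hQ u v
  rwa [hs v u, ← sq] at this

namespace IsCompactPair

variable {Q G N : BilinForm ℝ H} {θ : ℝ}

theorem symmN (h : IsCompactPair Q G N θ) (u v : H) : N u v = N v u := by
  rw [h.N_eq, h.N_eq, h.symmG, h.symmQ]

/-- `Q` is bounded with respect to `N`. -/
theorem exists_Q_le (h : IsCompactPair Q G N θ) : ∃ C : ℝ, 0 < C ∧ ∀ u, Q u u ≤ C * N u u := by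
  by_contra! hcon
  have hseq : ∀ k : ℕ, ∃ u, N u u ≤ 1 ∧ (k : ℝ) < Q u u := by
    intro k
    obtain ⟨u, hu⟩ := hcon (k + 1) (by positivity)
    have hu0 : u ≠ 0 := by
      rintro rfl
      simp at hu
    have hN := h.posN u hu0
    refine ⟨(√(N u u))⁻¹ • u, ?_, ?_⟩
    · simp only [map_smul, LinearMap.smul_apply, smul_eq_mul]
      rw [← mul_assoc, ← mul_inv, Real.mul_self_sqrt hN.le, inv_mul_cancel₀ hN.ne']
    · simp only [map_smul, LinearMap.smul_apply, smul_eq_mul]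
      rw [← mul_assoc, ← mul_inv, Real.mul_self_sqrt hN.le, inv_mul_eq_div, lt_div_iff₀ hN]
      nlinarith
  choose u hu1 hu2 using hseq
  obtain ⟨v, φ, hφ, hQ, -⟩ := h.compact u ⟨1, hu1⟩
  obtain ⟨k, hk1, hk2⟩ := ((hQ.eventually (gt_mem_nhds one_pos)).and
    (eventually_ge_atTop ⌈2 + 2 * Q v v⌉₊)).exists
  have h1 := form_add_le (form_nonneg h.posQ) (u (φ k) - v) v
  rw [sub_add_cancel] at h1
  have h2 := hu2 (φ k)
  have h3 : (k : ℝ) ≤ φ k := by exact_mod_cast hφ.id_le k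
  have h4 : 2 + 2 * Q v v ≤ k := (Nat.le_ceil _).trans (by exact_mod_cast hk2)
  linarith

/-- A subspace on which `N` is controlled by `Q` is finite-dimensional, by Riesz's lemma. -/
theorem finiteDimensional_of_le (h : IsCompactPair Q G N θ) (F : Submodule ℝ H) (C : ℝ)
    (hF : ∀ u ∈ F, N u u ≤ C * Q u u) : FiniteDimensional ℝ F := by
  let core := innerCoreOfForm (N.restrict F) (fun u v => h.symmN u v)
    (fun u hu => h.posN u (by simpa using hu))
  let : NormedAddCommGroup F := core.toNormedAddCommGroup
  let : InnerProductSpace ℝ F := InnerProductSpace.ofCore core.toCore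
  have hnorm : ∀ u : F, N u u = ‖u‖ ^ 2 := fun u => real_inner_self_eq_norm_sq u
  by_contra hinf
  obtain ⟨R, f, hR, hfR, hf⟩ := exists_seq_norm_le_one_le_norm_sub (𝕜 := ℝ) (E := F) hinf
  obtain ⟨v, φ, hφ, hQ, -⟩ := h.compact (fun k => (f k : H)) ⟨R ^ 2, fun k => by
    rw [hnorm]
    exact pow_le_pow_left₀ (norm_nonneg _) (hfR k) 2⟩
  have hε : (0 : ℝ) < 1 / (4 * (|C| + 1)) := by positivity
  obtain ⟨k, hk⟩ := (hQ.eventually (gt_mem_nhds hε)).exists_forall_of_atTop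
  have h1 := hk k le_rfl
  have h2 := hk (k + 1) (Nat.le_succ k)
  have h3 : 1 ≤ ‖f (φ k) - f (φ (k + 1))‖ := hf (hφ (Nat.lt_succ_self k)).ne
  have h4 := hF _ (f (φ k) - f (φ (k + 1))).2
  rw [hnorm, Submodule.coe_sub] at h4
  have h5 := form_add_le (form_nonneg h.posQ) ((f (φ k) : H) - v) (v - f (φ (k + 1)))
  rw [sub_add_sub_cancel, ← neg_sub _ v] at h5
  simp only [LinearMap.map_neg, LinearMap.neg_apply, neg_neg] at h5
  set A := Q ((f (φ k) : H) - f (φ (k + 1))) ((f (φ k) : H) - f (φ (k + 1)))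
  have hA0 : 0 ≤ A := form_nonneg h.posQ _
  have hA : A < 1 / (|C| + 1) := by
    have : 1 / (|C| + 1) = 4 * (1 / (4 * (|C| + 1))) := by field_simp
    rw [this]
    linarith
  rw [lt_div_iff₀ (by positivity)] at hA
  have h6 : 1 ≤ ‖f (φ k) - f (φ (k + 1))‖ ^ 2 := one_le_pow₀ h3
  have h7 : C * A ≤ |C| * A := mul_le_mul_of_nonneg_right (le_abs_self C) hA0
  linarith

/-- There is a maximal subspace on which `q` is negative definite. -/
theorem exists_maximal_negDef (q : BilinForm ℝ H) :
    ∃ V : Submodule ℝ H, Maximal (· ∈ {V : Submodule ℝ H | ∀ v ∈ V, v ≠ 0 → q v v < 0}) V := by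
  refine zorn_le₀ _ fun c hc hchain => ?_
  rcases c.eq_empty_or_nonempty with rfl | hne
  · exact ⟨⊥, fun v hv hv0 => absurd (by simpa using hv) hv0, by simp⟩
  · refine ⟨sSup c, fun v hv hv0 => ?_, fun z hz => le_sSup hz⟩
    obtain ⟨y, hy, hvy⟩ := (Submodule.mem_sSup_of_directed hne hchain.directedOn).1 hv
    exact hc hy v hvy hv0

/-- By maximality of `V`, the form `q` is nonnegative on the `q`-orthogonal complement of `V`. -/
theorem nonneg_of_maximal_negDef {q : BilinForm ℝ H} (hq : ∀ u v, q u v = q v u)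
    {V : Submodule ℝ H}
    (hV : Maximal (· ∈ {V : Submodule ℝ H | ∀ v ∈ V, v ≠ 0 → q v v < 0}) V) {z : H}
    (hz : ∀ v ∈ V, q v z = 0) : 0 ≤ q z z := by
  by_contra! hneg
  have hmem : V ⊔ Submodule.span ℝ {z} ∈
      {V : Submodule ℝ H | ∀ v ∈ V, v ≠ 0 → q v v < 0} := by
    intro u hu hu0
    obtain ⟨v, hv, w, hw, rfl⟩ := Submodule.mem_sup.1 hu
    obtain ⟨a, rfl⟩ := Submodule.mem_span_singleton.1 hw
    have hexp : q (v + a • z) (v + a • z) = q v v + a ^ 2 * q z z := by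
      simp only [map_add, map_smul, LinearMap.add_apply, LinearMap.smul_apply, smul_eq_mul,
        hq z v, hz v hv]
      ring
    rw [hexp]
    rcases eq_or_ne v 0 with rfl | hv0
    · have ha : a ≠ 0 := by
        rintro rfl
        simp at hu0
      have : 0 < a ^ 2 := by positivity
      simp only [map_zero, zero_add]
      exact mul_neg_of_pos_of_neg this hneg
    · nlinarith [hV.1 v hv hv0, sq_nonneg a]
  have hzV : z ∈ V := hV.2 hmem le_sup_left
    (Submodule.mem_sup_right (Submodule.mem_span_singleton_self z))
  exact hneg.ne (hz z hzV)

/-- Every level of a compact pair has a splitting. -/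
theorem exists_isSplitting (h : IsCompactPair Q G N θ) (lam : ℝ) :
    ∃ V E : Submodule ℝ H, ∃ δ : ℝ, IsSplitting Q G N lam V E δ := by
  set q : BilinForm ℝ H := G - lam • Q with hqdef
  have hqa : ∀ u v, q u v = G u v - lam * Q u v := fun u v => by simp [hqdef]
  have hqN : ∀ u, N u u = q u u + (lam + θ) * Q u u := fun u => by
    rw [hqa, h.N_eq]
    ring
  have hqs : ∀ u v, q u v = q v u := fun u v => by rw [hqa, hqa, h.symmG, h.symmQ]
  obtain ⟨V, hV⟩ := exists_maximal_negDef q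
  have hVneg : ∀ v ∈ V, v ≠ 0 → q v v < 0 := hV.1
  have hVfin : FiniteDimensional ℝ V := by
    refine h.finiteDimensional_of_le V (lam + θ) fun v hv => ?_
    rw [hqN]
    rcases eq_or_ne v 0 with rfl | hv0
    · simp
    · linarith [hVneg v hv hv0]
  have hZ : ∀ z, (∀ v ∈ V, q v z = 0) → 0 ≤ q z z := fun z hz =>
    nonneg_of_maximal_negDef hqs hV hz
  set E : Submodule ℝ H := LinearMap.ker q with hEdef
  have hEmem : ∀ e, e ∈ E ↔ ∀ u, q e u = 0 := fun e => by
    rw [hEdef, LinearMap.mem_ker, LinearMap.ext_iff]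
    rfl
  have hEfin : FiniteDimensional ℝ E := by
    refine h.finiteDimensional_of_le E (lam + θ) fun e he => ?_
    rw [hqN, (hEmem e).1 he, zero_add]
  -- Negativity on `V` is uniform because `V` is finite-dimensional; the lemma on convergent families
  -- is applied to a constant one.
  obtain ⟨η, hη0, hη⟩ : ∃ η : ℝ, 0 < η ∧ ∀ v ∈ V, η * N v v ≤ -q v v := by
    obtain ⟨η, hη0, hη⟩ := eventually_form_ge (l := (⊤ : Filter Unit)) (-q.restrict V)
      (N.restrict V) (fun _ => -q.restrict V) (fun u v => by simp [hqs u.1 v.1])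
      (fun u hu => by simpa using hVneg u u.2 (by simpa using hu)) (fun u v => h.symmN u v)
      (fun u v => tendsto_const_nhds)
    refine ⟨η, hη0, fun v hv => ?_⟩
    obtain ⟨_, hi⟩ := hη.exists
    simpa using hi ⟨v, hv⟩
  let Z : Submodule ℝ H :=
    { carrier := {z | ∀ v ∈ V, q v z = 0}
      zero_mem' := by simp
      add_mem' := fun {a b} ha hb v hv => by rw [map_add, ha v hv, hb v hv, add_zero]
      smul_mem' := fun c a ha v hv => by rw [map_smul, ha v hv, smul_zero] }
  have hcs : ∀ z ∈ Z, ∀ w ∈ Z, |q z w| ≤ √(q z z) * √(q w w) := fun z hz w hw =>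
    form_cauchySchwarz (Q := q.restrict Z) (fun u v => hqs u v) (fun u => hZ u u.2)
      ⟨z, hz⟩ ⟨w, hw⟩
  obtain ⟨δ, hδ0, hδ⟩ : ∃ δ : ℝ, 0 < δ ∧ ∀ w ∈ Z, (∀ e ∈ E, Q e w = 0) →
      δ * N w w ≤ q w w := by
    by_contra! hcon
    have hseq : ∀ k : ℕ, ∃ w ∈ Z, (∀ e ∈ E, Q e w = 0) ∧ N w w = 1 ∧
        q w w < 1 / ((k : ℝ) + 1) := by
      intro k
      obtain ⟨w, hwZ, hwE, hw⟩ := hcon (1 / ((k : ℝ) + 1)) (by positivity)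
      have hw0 : w ≠ 0 := by
        rintro rfl
        simp at hw
      have hN := h.posN w hw0
      refine ⟨(√(N w w))⁻¹ • w, Z.smul_mem _ hwZ, fun e he => by simp [hwE e he], ?_, ?_⟩
      · simp only [map_smul, LinearMap.smul_apply, smul_eq_mul]
        rw [← mul_assoc, ← mul_inv, Real.mul_self_sqrt hN.le, inv_mul_cancel₀ hN.ne']
      · simp only [map_smul, LinearMap.smul_apply, smul_eq_mul]
        rw [← mul_assoc, ← mul_inv, Real.mul_self_sqrt hN.le, inv_mul_eq_div, div_lt_iff₀ hN]
        exact hw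
    choose w hwZ hwE hwN hwq using hseq
    obtain ⟨v, φ, hφ, hQ, hG⟩ := h.compact w ⟨1, fun k => (hwN k).le⟩
    have hqlim : Tendsto (fun k => q (w (φ k)) (w (φ k))) atTop (𝓝 0) := by
      refine squeeze_zero (fun k => hZ _ (hwZ _)) (fun k => (hwq (φ k)).le) ?_
      exact tendsto_one_div_add_atTop_nhds_zero_nat.comp hφ.tendsto_atTop
    have hQw : ∀ y, Tendsto (fun k => Q (w (φ k)) y) atTop (𝓝 (Q v y)) := by
      intro y
      rw [tendsto_iff_norm_sub_tendsto_zero]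
      have hsq := (Real.continuous_sqrt.tendsto 0).comp hQ
      have := hsq.mul_const (√(Q y y))
      rw [Real.sqrt_zero, zero_mul] at this
      refine squeeze_zero (fun _ => norm_nonneg _) (fun k => ?_) this
      rw [Real.norm_eq_abs, ← LinearMap.sub_apply, ← map_sub]
      exact form_cauchySchwarz h.symmQ (form_nonneg h.posQ) _ _
    have hqw : ∀ y, Tendsto (fun k => q (w (φ k)) y) atTop (𝓝 (q v y)) := by
      intro y
      simp only [hqa]
      exact (hG y).sub ((hQw y).const_mul lam)
    have hvZ : v ∈ Z := by
      intro y hy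
      rw [hqs]
      refine tendsto_nhds_unique (hqw y) ?_
      simp only [fun k => (hqs (w (φ k)) y).trans (hwZ (φ k) y hy)]
      exact tendsto_const_nhds
    -- The weak limit is isotropic in the nonnegative space `Z`, hence in the kernel of `q`.
    have hvzero : ∀ z ∈ Z, q v z = 0 := by
      intro z hz
      refine tendsto_nhds_unique (hqw z) ?_
      have hsq := ((Real.continuous_sqrt.tendsto 0).comp hqlim).mul_const (√(q z z))
      rw [Real.sqrt_zero, zero_mul] at hsq
      exact squeeze_zero_norm (fun k => hcs _ (hwZ _) z hz) hsq
    have hvE : v ∈ E := by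
      rw [hEmem]
      intro u
      obtain ⟨y, hy, hyu⟩ := exists_orthogonal_projection (-q) (fun u v => by simp [hqs u v]) V
        (fun u hu hu0 => by simpa using hVneg u hu hu0) u
      have h1 : q v (u - y) = 0 := hvzero _ fun x hx =>
        neg_eq_zero.1 (hyu x hx)
      have h2 : q v y = 0 := by
        rw [hqs]
        exact hvZ y hy
      rw [map_sub, h2, sub_zero] at h1
      exact h1
    have hv0 : v = 0 := by
      by_contra hne
      refine (h.posQ v hne).ne' (tendsto_nhds_unique (hQw v) ?_)
      simp only [fun k => (h.symmQ (w (φ k)) v).trans (hwE (φ k) v hvE)]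
      exact tendsto_const_nhds
    subst hv0
    have h1 : Tendsto (fun k => N (w (φ k)) (w (φ k))) atTop (𝓝 0) := by
      simp only [hqN]
      simpa using hqlim.add (hQ.const_mul (lam + θ))
    simp only [hwN] at h1
    exact one_ne_zero (tendsto_nhds_unique tendsto_const_nhds h1)
  have hNnn := form_nonneg h.posN
  refine ⟨V, E, min η δ, hVfin, hEfin, lt_min hη0 hδ0, fun v hv => ?_, fun e => ?_,
    fun w hw1 hw2 => ?_⟩
  · rw [← hqa]
    nlinarith [hη v hv, mul_le_mul_of_nonneg_right (min_le_left η δ) (hNnn v)]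
  · simp only [hEmem, hqa, sub_eq_zero]
  · rw [← hqa]
    have := hδ w (fun v hv => by rw [hqa, hw1 v hv, sub_self]) hw2
    nlinarith [mul_le_mul_of_nonneg_right (min_le_right η δ) (hNnn w)]

end IsCompactPair

end Splitting

/-! ### First-order perturbation at a spectral level -/

section Perturbation

open LinearMap (BilinForm)

variable {H : Type*} [AddCommGroup H] [Module ℝ H]

/-- Let `p` have `F` in its kernel and be uniformly positive on `W`, and let `P i` be a perturbation
of `p` of order `t i` with respect to `N`, whose derivative on `F` is positive definite. Then `P i`
is eventually nonnegative on `F + W`: on `F` it is only of order `t i`, but the cross term is of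
order `t i` as well, hence absorbed by the terms on `F` and on `W`. -/
theorem eventually_perturbed_form_nonneg {ι : Type*} {l : Filter ι} {t : ι → ℝ}
    (ht0 : ∀ᶠ i in l, 0 < t i) (ht : Tendsto t l (𝓝 0)) {N p d : BilinForm ℝ H}
    {P : ι → BilinForm ℝ H} (hNs : ∀ u v, N u v = N v u) (hN : ∀ u, 0 ≤ N u u)
    (hPs : ∀ i u v, P i u v = P i v u) {F W : Submodule ℝ H} [FiniteDimensional ℝ F]
    {δ K : ℝ} (hδ : 0 < δ) (hp : ∀ e ∈ F, ∀ u, p e u = 0)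
    (hW : ∀ w ∈ W, δ * N w w ≤ p w w)
    (hK : ∀ᶠ i in l, ∀ u v, |P i u v - p u v| ≤ K * t i * (√(N u u) * √(N v v)))
    (hds : ∀ u v, d u v = d v u) (hdpos : ∀ e ∈ F, e ≠ 0 → 0 < d e e)
    (hlim : ∀ e ∈ F, ∀ e' ∈ F, Tendsto (fun i => P i e e' / t i) l (𝓝 (d e e'))) :
    ∀ᶠ i in l, ∀ e ∈ F, ∀ w ∈ W, 0 ≤ P i (e + w) (e + w) := by
  obtain ⟨η, hη0, hη⟩ := eventually_form_ge (d.restrict F) (N.restrict F)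
    (fun i => (t i)⁻¹ • (P i).restrict F) (fun u v => hds u v)
    (fun u hu => hdpos u u.2 (by simpa using hu)) (fun u v => hNs u v)
    (fun u v => by simpa [div_eq_inv_mul] using hlim u u.2 v v.2)
  -- Smallness of `t` makes the discriminant of the resulting quadratic form nonpositive.
  have hdisc : ∀ᶠ i in l, K ^ 2 * t i < η * (δ - K * t i) ∧ 0 < δ - K * t i := by
    have h1 : Tendsto (fun i => η * (δ - K * t i) - K ^ 2 * t i) l (𝓝 (η * δ)) := by
      have := ((tendsto_const_nhds (x := δ)).sub (ht.const_mul K)).const_mul η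
      simpa using this.sub (ht.const_mul (K ^ 2))
    have h2 : Tendsto (fun i => δ - K * t i) l (𝓝 δ) := by
      simpa using (tendsto_const_nhds (x := δ)).sub (ht.const_mul K)
    filter_upwards [h1.eventually (lt_mem_nhds (mul_pos hη0 hδ)),
      h2.eventually (lt_mem_nhds hδ)] with i h3 h4
    exact ⟨by linarith, h4⟩
  filter_upwards [ht0, hη, hK, hdisc] with i hti hηi hKi hdi e he w hw
  have hexp : P i (e + w) (e + w) = P i e e + 2 * P i e w + P i w w := by
    simp only [map_add, LinearMap.add_apply, hPs i w e]
    ring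
  have h1 : t i * (η * N e e) ≤ P i e e := by
    have h : η * N e e ≤ (t i)⁻¹ * P i e e := hηi ⟨e, he⟩
    rwa [inv_mul_eq_div, le_div_iff₀ hti, mul_comm] at h
  have h2 := (abs_le.1 (hKi e w)).1
  rw [hp e he, sub_zero] at h2
  have h3 := (abs_le.1 (hKi w w)).1
  rw [Real.mul_self_sqrt (hN w)] at h3
  have h4 := hW w hw
  set a := √(N e e)
  set b := √(N w w)
  have ha2 : N e e = a ^ 2 := (Real.sq_sqrt (hN e)).symm
  have hb2 : N w w = b ^ 2 := (Real.sq_sqrt (hN w)).symm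
  rw [ha2] at h1
  rw [hb2] at h3 h4
  rw [hexp]
  have hmain : 0 ≤ t i * η * a ^ 2 - 2 * (K * t i) * (a * b) + (δ - K * t i) * b ^ 2 := by
    obtain ⟨hd1, hd2⟩ := hdi
    set m := δ - K * t i
    have h5 : 0 ≤ m * (t i * η * a ^ 2 - 2 * (K * t i) * (a * b) + m * b ^ 2) := by
      have : m * (t i * η * a ^ 2 - 2 * (K * t i) * (a * b) + m * b ^ 2) =
        (m * b - K * t i * a) ^ 2 + t i * a ^ 2 * (η * m - K ^ 2 * t i) := by ring
      rw [this]
      have := mul_nonneg (mul_nonneg hti.le (sq_nonneg a)) (sub_nonneg.2 hd1.le)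
      positivity
    exact nonneg_of_mul_nonneg_right h5 hd2
  nlinarith

/-- A family `Qi`, `Gi` of pairs of symmetric forms is a first-order perturbation of size `t` of the
pair `Q`, `G` at the level `lam`: the differences are `O(t)` with respect to `N`, and on the kernel
`E` of `G - lam Q` the form `Gi - lam Qi` has derivative `D`. -/
structure IsFirstOrderPerturbation {ι : Type*} (l : Filter ι) (t : ι → ℝ)
    (Q G N D : BilinForm ℝ H) (Qi Gi : ι → BilinForm ℝ H) (lam : ℝ) (E : Submodule ℝ H) (K : ℝ) :
    Prop where
  t_pos : ∀ᶠ i in l, 0 < t i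
  t_lim : Tendsto t l (𝓝 0)
  symmQi : ∀ i u v, Qi i u v = Qi i v u
  symmGi : ∀ i u v, Gi i u v = Gi i v u
  symmD : ∀ u v, D u v = D v u
  boundQ : ∀ᶠ i in l, ∀ u v, |Qi i u v - Q u v| ≤ K * t i * (√(N u u) * √(N v v))
  boundG : ∀ᶠ i in l, ∀ u v, |Gi i u v - G u v| ≤ K * t i * (√(N u u) * √(N v v))
  lim : ∀ e ∈ E, ∀ e' ∈ E,
    Tendsto (fun i => (Gi i e e' - lam * Qi i e e') / t i) l (𝓝 (D e e'))

namespace IsFirstOrderPerturbation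

variable {ι : Type*} {l : Filter ι} {t : ι → ℝ} {Q G N D : BilinForm ℝ H}
  {Qi Gi : ι → BilinForm ℝ H} {lam K θ : ℝ} {V E : Submodule ℝ H} {δ : ℝ}

/-- The bounds persist for the forms `Gi - (lam + t c) Qi`. -/
theorem bound_level (hP : IsFirstOrderPerturbation l t Q G N D Qi Gi lam E K)
    (h : IsCompactPair Q G N θ) (c : ℝ) :
    ∃ K', ∀ᶠ i in l, ∀ u v, |(Gi i u v - (lam + t i * c) * Qi i u v) - (G u v - lam * Q u v)| ≤
      K' * t i * (√(N u u) * √(N v v)) := by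
  obtain ⟨C, hC0, hC⟩ := h.exists_Q_le
  have hNnn := form_nonneg h.posN
  have hQb : ∀ u v, |Q u v| ≤ C * (√(N u u) * √(N v v)) := by
    intro u v
    refine (form_cauchySchwarz h.symmQ (form_nonneg h.posQ) u v).trans ?_
    have h1 : ∀ u, √(Q u u) ≤ √C * √(N u u) := fun u => by
      rw [← Real.sqrt_mul hC0.le]
      exact Real.sqrt_le_sqrt (hC u)
    calc √(Q u u) * √(Q v v) ≤ (√C * √(N u u)) * (√C * √(N v v)) :=
          mul_le_mul (h1 u) (h1 v) (Real.sqrt_nonneg _) (by positivity)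
      _ = (√C * √C) * (√(N u u) * √(N v v)) := by ring
      _ = _ := by rw [Real.mul_self_sqrt hC0.le]
  refine ⟨K + (|lam| + |c|) * K + |c| * C, ?_⟩
  filter_upwards [hP.t_pos, hP.boundQ, hP.boundG,
    hP.t_lim.eventually (gt_mem_nhds one_pos)] with i hti hQi hGi ht1 u v
  set s := √(N u u) * √(N v v)
  have hs : 0 ≤ s := by positivity
  have e1 : (Gi i u v - (lam + t i * c) * Qi i u v) - (G u v - lam * Q u v) =
      (Gi i u v - G u v) - (lam + t i * c) * (Qi i u v - Q u v) - t i * c * Q u v := by ring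
  have h1 : |lam + t i * c| ≤ |lam| + |c| := by
    refine (abs_add_le _ _).trans ?_
    rw [abs_mul, abs_of_pos hti]
    nlinarith [abs_nonneg c]
  rw [e1]
  calc _ ≤ |Gi i u v - G u v| + |lam + t i * c| * |Qi i u v - Q u v| + |t i * c| * |Q u v| := by
        refine (abs_sub _ _).trans ?_
        rw [abs_mul (t i * c)]
        refine add_le_add_left ((abs_sub _ _).trans ?_) _
        rw [abs_mul]
    _ ≤ K * t i * s + (|lam| + |c|) * (K * t i * s) + (t i * |c|) * (C * s) := by
        rw [abs_mul (t i), abs_of_pos hti]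
        refine add_le_add (add_le_add (hGi u v) ?_) ?_
        · exact mul_le_mul h1 (hQi u v) (abs_nonneg _) (by positivity)
        · exact mul_le_mul_of_nonneg_left (hQb u v) (by positivity)
    _ = _ := by ring

/-- On `E` the derivative of `Gi - (lam + t c) Qi` is `D - c Q`. -/
theorem lim_level (hP : IsFirstOrderPerturbation l t Q G N D Qi Gi lam E K) (c : ℝ) {e e' : H}
    (he : e ∈ E) (he' : e' ∈ E) :
    Tendsto (fun i => (Gi i e e' - (lam + t i * c) * Qi i e e') / t i) l
      (𝓝 (D e e' - c * Q e e')) := by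
  have hQlim : Tendsto (fun i => Qi i e e') l (𝓝 (Q e e')) := by
    rw [tendsto_iff_norm_sub_tendsto_zero]
    have := (hP.t_lim.const_mul K).mul_const (√(N e e) * √(N e' e'))
    rw [mul_zero, zero_mul] at this
    exact squeeze_zero' (Eventually.of_forall fun _ => norm_nonneg _)
      (hP.boundQ.mono fun i hi => hi e e') this
  refine ((hP.lim e he e' he').sub (hQlim.const_mul c)).congr' ?_
  filter_upwards [hP.t_pos] with i hti
  field_simp
  ring

/-- Upper test space: near the level `lam`, the sum of `V` and of the span of the first `j + 1`
eigenvectors of `D` carries Rayleigh quotients at most `lam + t c`. -/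
theorem eventually_exists_upper (hP : IsFirstOrderPerturbation l t Q G N D Qi Gi lam E K)
    (h : IsCompactPair Q G N θ) (hS : IsSplitting Q G N lam V E δ) {m : ℕ}
    (e : Module.Basis (Fin m) ℝ E) (hQe : ∀ i j, Q (e i) (e j) = if i = j then 1 else 0)
    (hDe : ∀ i j, i ≠ j → D (e i) (e j) = 0) (hmono : Monotone fun i => D (e i) (e i))
    (j : Fin m) {c : ℝ} (hc : D (e j) (e j) < c) :
    ∃ F : Submodule ℝ H, Module.finrank ℝ F = Module.finrank ℝ V + 1 + j ∧
      ∀ᶠ i in l, ∀ u ∈ F, Gi i u u ≤ (lam + t i * c) * Qi i u u := by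
  have := hS.finV
  have := hS.finE
  set F₀ : Submodule ℝ E := initialSpan e (p := j + 1) j.2
  set F₁ : Submodule ℝ H := F₀.map E.subtype
  have hF₁E : ∀ u ∈ F₁, ∃ x ∈ F₀, (x : H) = u := fun u hu => by simpa [F₁] using hu
  have hF₁r : Module.finrank ℝ F₁ = j + 1 := by
    rw [← finrank_initialSpan e (p := j + 1) j.2]
    exact (LinearEquiv.finrank_eq (F₀.equivMapOfInjective E.subtype E.injective_subtype)).symm
  have hdisj : F₁ ⊓ V = ⊥ := by
    rw [eq_bot_iff]
    rintro u ⟨hu, huV⟩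
    obtain ⟨x, -, rfl⟩ := hF₁E u hu
    have h1 := hS.neg_on _ huV
    rw [(hS.mem_iff x).1 x.2, sub_self] at h1
    by_contra hne
    have := mul_pos hS.pos (h.posN x (by simpa using hne))
    linarith
  refine ⟨F₁ ⊔ V, ?_, ?_⟩
  · have := Submodule.finrank_sup_add_finrank_inf_eq F₁ V
    rw [hdisj, finrank_bot, hF₁r] at this
    omega
  · obtain ⟨K', hK'⟩ := hP.bound_level h c
    have hmain := eventually_perturbed_form_nonneg (N := N) (p := -(G - lam • Q))
      (d := -(D - c • Q)) (P := fun i => -(Gi i - (lam + t i * c) • Qi i)) (F := F₁) (W := V)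
      (K := K') hP.t_pos hP.t_lim h.symmN (form_nonneg h.posN)
      (fun i u v => by simp [hP.symmQi i u v, hP.symmGi i u v]) hS.pos
      (fun u hu v => by
        obtain ⟨x, -, rfl⟩ := hF₁E u hu
        simp [(hS.mem_iff x).1 x.2])
      (fun w hw => by
        have := hS.neg_on w hw
        simp only [LinearMap.neg_apply, LinearMap.sub_apply, LinearMap.smul_apply, smul_eq_mul]
        linarith)
      (hK'.mono fun i hi u v => by
        refine le_trans (le_of_eq ?_) (hi u v)
        rw [← abs_neg]
        congr 1
        simp only [LinearMap.neg_apply, LinearMap.sub_apply, LinearMap.smul_apply, smul_eq_mul]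
        ring)
      (fun u v => by simp [hP.symmD u v, h.symmQ u v])
      (fun u hu hu0 => by
        obtain ⟨x, hx, rfl⟩ := hF₁E u hu
        have h1 := form_le_of_mem_initialSpan e (Q.restrict E) (D.restrict E) hQe hDe hmono j hx
        have h2 := h.posQ x hu0
        have h3 : D x x ≤ D (e j) (e j) * Q x x := h1
        simp only [LinearMap.neg_apply, LinearMap.sub_apply, LinearMap.smul_apply, smul_eq_mul]
        nlinarith)
      (fun u hu v hv => by
        obtain ⟨x, hx, rfl⟩ := hF₁E u hu
        obtain ⟨y, hy, rfl⟩ := hF₁E v hv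
        exact (hP.lim_level c x.2 y.2).neg.congr fun i => (neg_div _ _).symm)
    refine hmain.mono fun i hi u hu => ?_
    obtain ⟨a, ha, b, hb, rfl⟩ := Submodule.mem_sup.1 hu
    have := hi a ha b hb
    simp only [LinearMap.neg_apply, LinearMap.sub_apply, LinearMap.smul_apply, smul_eq_mul] at this
    linarith

/-- Lower bound: every subspace of dimension `finrank V + 1 + j` contains a vector with Rayleigh
quotient at least `lam + t c`, namely one orthogonal to `V` and to the first `j` eigenvectors
of `D`. -/
theorem eventually_forall_lower (hP : IsFirstOrderPerturbation l t Q G N D Qi Gi lam E K)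
    (h : IsCompactPair Q G N θ) (hS : IsSplitting Q G N lam V E δ) {m : ℕ}
    (e : Module.Basis (Fin m) ℝ E) (hQe : ∀ i j, Q (e i) (e j) = if i = j then 1 else 0)
    (hDe : ∀ i j, i ≠ j → D (e i) (e j) = 0) (hmono : Monotone fun i => D (e i) (e i))
    (j : Fin m) {c : ℝ} (hc : c < D (e j) (e j)) :
    ∀ᶠ i in l, ∀ F : Submodule ℝ H, Module.finrank ℝ F = Module.finrank ℝ V + 1 + j →
      ∃ u ∈ F, u ≠ 0 ∧ (lam + t i * c) * Qi i u u ≤ Gi i u u := by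
  have := hS.finV
  have := hS.finE
  let F₁ : Submodule ℝ H := (⨅ i : Fin j, LinearMap.ker (e.coord (Fin.castLE j.2.le i))).map
    E.subtype
  have hF₁E : ∀ u ∈ F₁, ∃ x : E, (∀ i < j, e.repr x i = 0) ∧ (x : H) = u := by
    rintro _ ⟨x, hx, rfl⟩
    refine ⟨x, fun i hi => ?_, rfl⟩
    have := (Submodule.mem_iInf _).1 hx ⟨i, hi⟩
    simpa using this
  have hF₁fin : FiniteDimensional ℝ F₁ := inferInstance
  let W : Submodule ℝ H :=
    { carrier := {w | (∀ v ∈ V, G v w = lam * Q v w) ∧ ∀ x ∈ E, Q x w = 0}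
      zero_mem' := by simp
      add_mem' := fun {a b} ha hb =>
        ⟨fun v hv => by rw [map_add, map_add, ha.1 v hv, hb.1 v hv, mul_add],
          fun x hx => by rw [map_add, ha.2 x hx, hb.2 x hx, add_zero]⟩
      smul_mem' := fun a w hw =>
        ⟨fun v hv => by
          simp only [map_smul, smul_eq_mul, hw.1 v hv]
          ring,
          fun x hx => by rw [map_smul, hw.2 x hx, smul_zero]⟩ }
  obtain ⟨K', hK'⟩ := hP.bound_level h c
  have hmain := eventually_perturbed_form_nonneg (N := N) (p := G - lam • Q)
    (d := D - c • Q) (P := fun i => Gi i - (lam + t i * c) • Qi i) (F := F₁) (W := W)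
    (K := K') hP.t_pos hP.t_lim h.symmN (form_nonneg h.posN)
    (fun i u v => by simp [hP.symmQi i u v, hP.symmGi i u v]) hS.pos
    (fun u hu v => by
      obtain ⟨x, -, rfl⟩ := hF₁E u hu
      simp [(hS.mem_iff x).1 x.2])
    (fun w hw => hS.pos_on w hw.1 hw.2)
    hK'
    (fun u v => by simp [hP.symmD u v, h.symmQ u v])
    (fun u hu hu0 => by
      obtain ⟨x, hx, rfl⟩ := hF₁E u hu
      have h1 := form_ge_of_repr_eq_zero e (Q.restrict E) (D.restrict E) hQe hDe hmono j hx
      have h2 := h.posQ x hu0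
      have h3 : D (e j) (e j) * Q x x ≤ D x x := h1
      simp only [LinearMap.sub_apply, LinearMap.smul_apply, smul_eq_mul]
      nlinarith)
    (fun u hu v hv => by
      obtain ⟨x, hx, rfl⟩ := hF₁E u hu
      obtain ⟨y, hy, rfl⟩ := hF₁E v hv
      exact hP.lim_level c x.2 y.2)
  refine hmain.mono fun i hi F hF => ?_
  have hFfin : FiniteDimensional ℝ F := Module.finite_of_finrank_pos (by omega)
  obtain ⟨u, huF, hu0, hu⟩ := exists_ne_zero_mem_ker F
    (((V.subtype.dualMap ∘ₗ (G - lam • Q)).prod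
      (LinearMap.pi fun i : Fin j => Q (e (Fin.castLE j.2.le i)))) :
      H →ₗ[ℝ] Module.Dual ℝ V × (Fin j → ℝ))
    (by rw [hF, Module.finrank_prod, Subspace.dual_finrank_eq]; simp)
  have hu1 : (V.subtype.dualMap ∘ₗ (G - lam • Q)) u = 0 := congrArg Prod.fst hu
  have hu2 : (LinearMap.pi fun i : Fin j => Q (e (Fin.castLE j.2.le i))) u = 0 :=
    congrArg Prod.snd hu
  have huV : ∀ v ∈ V, G v u = lam * Q v u := by
    intro v hv
    have h1 : G u v - lam * Q u v = 0 := LinearMap.congr_fun hu1 ⟨v, hv⟩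
    rw [h.symmG v, h.symmQ v]
    linarith
  have hue : ∀ i < j, Q (e i) u = 0 := fun i hi => congrFun hu2 ⟨i, hi⟩
  obtain ⟨x, hxE, hx⟩ := exists_orthogonal_projection Q h.symmQ E
    (fun v _ hv0 => h.posQ v hv0) u
  have hxF : x ∈ F₁ := by
    refine ⟨⟨x, hxE⟩, (Submodule.mem_iInf _).2 fun i => ?_, rfl⟩
    set i' := Fin.castLE j.2.le i
    have hi'j : i' < j := i.2
    have h1 : Q (e i') x = 0 := by
      have := hx _ (e i').2
      rw [map_sub, hue i' hi'j, zero_sub, neg_eq_zero] at this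
      exact this
    have h2 := form_apply_of_diagonal e (Q.restrict E)
      (fun a b hab => (hQe a b).trans (if_neg hab)) (e i') ⟨x, hxE⟩
    have h3 : Q (e i') x = ∑ a, Q (e a) (e a) * (e.repr (e i') a * e.repr ⟨x, hxE⟩ a) := h2
    rw [h1, Finset.sum_eq_single i' (fun a _ ha => by simp [ha.symm])
      (by simp)] at h3
    simpa [hQe] using h3.symm
  have hw : u - x ∈ W := by
    refine ⟨fun v hv => ?_, hx⟩
    have h1 := (hS.mem_iff x).1 hxE v
    rw [map_sub, map_sub, huV v hv, h.symmG v x, h.symmQ v x, h1]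
    ring
  have h1 := hi x hxF (u - x) hw
  rw [add_sub_cancel] at h1
  refine ⟨u, huF, hu0, ?_⟩
  simp only [LinearMap.sub_apply, LinearMap.smul_apply, smul_eq_mul] at h1
  linarith

end IsFirstOrderPerturbation

end Perturbation

/-! ### Rayleigh quotients on subspaces of prescribed dimension -/

section Counting

open LinearMap (BilinForm)

variable {H : Type*} [AddCommGroup H] [Module ℝ H]

theorem exists_submodule_le_finrank_eq (F : Submodule ℝ H) [FiniteDimensional ℝ F] {j : ℕ}
    (hj : j ≤ Module.finrank ℝ F) : ∃ F' ≤ F, Module.finrank ℝ F' = j := by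
  refine ⟨(initialSpan (Module.finBasis ℝ F) hj).map F.subtype, F.map_subtype_le _, ?_⟩
  exact (LinearEquiv.finrank_eq (Submodule.equivMapOfInjective F.subtype
    F.injective_subtype _)).symm.trans (finrank_initialSpan (Module.finBasis ℝ F) hj)

theorem exists_form_le {Q G : BilinForm ℝ H} (hQs : ∀ u v, Q u v = Q v u)
    (hQ : ∀ u, u ≠ 0 → 0 < Q u u) (hGs : ∀ u v, G u v = G v u) (F : Submodule ℝ H)
    (hF : 0 < Module.finrank ℝ F) : ∃ c : ℝ, ∀ u ∈ F, G u u ≤ c * Q u u := by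
  have := Module.finite_of_finrank_pos hF
  obtain ⟨u, -, hu⟩ := exists_isGreatest_rayleigh (Q.restrict F) (G.restrict F) hF
    (fun u v => hQs u v) (fun u hu => hQ u (by simpa using hu)) (fun u v => hGs u v)
  exact ⟨_, fun v hv => hu ⟨v, hv⟩⟩

namespace IsSplitting

variable {Q G N : BilinForm ℝ H} {lam θ : ℝ} {V E : Submodule ℝ H} {δ : ℝ}

theorem exists_below (hS : IsSplitting Q G N lam V E δ) (h : IsCompactPair Q G N θ) {j : ℕ}
    (hj : j ≤ Module.finrank ℝ V) :
    ∃ ε : ℝ, 0 < ε ∧ ∃ F : Submodule ℝ H, Module.finrank ℝ F = j ∧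
      ∀ u ∈ F, G u u ≤ (lam - ε) * Q u u := by
  have := hS.finV
  obtain ⟨C, hC0, hC⟩ := h.exists_Q_le
  obtain ⟨F, hFV, hF⟩ := exists_submodule_le_finrank_eq V hj
  refine ⟨δ / C, div_pos hS.pos hC0, F, hF, fun u hu => ?_⟩
  have h1 := hS.neg_on u (hFV hu)
  have h2 : δ / C * Q u u ≤ δ * N u u := by
    rw [div_mul_eq_mul_div, div_le_iff₀ hC0]
    nlinarith [hC u, hS.pos]
  linarith

theorem exists_le (hS : IsSplitting Q G N lam V E δ) (h : IsCompactPair Q G N θ) {j : ℕ}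
    (hj : j ≤ Module.finrank ℝ V + Module.finrank ℝ E) :
    ∃ F : Submodule ℝ H, Module.finrank ℝ F = j ∧ ∀ u ∈ F, G u u ≤ lam * Q u u := by
  have := hS.finV
  have := hS.finE
  have hdisj : V ⊓ E = ⊥ := by
    rw [eq_bot_iff]
    rintro u ⟨huV, huE⟩
    have h1 := hS.neg_on _ huV
    rw [(hS.mem_iff u).1 huE, sub_self] at h1
    by_contra hne
    have := mul_pos hS.pos (h.posN u (by simpa using hne))
    linarith
  have hdim := Submodule.finrank_sup_add_finrank_inf_eq V E
  rw [hdisj, finrank_bot, add_zero] at hdim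
  obtain ⟨F, hFle, hF⟩ := exists_submodule_le_finrank_eq (V ⊔ E) (hj.trans hdim.ge)
  refine ⟨F, hF, fun u hu => ?_⟩
  obtain ⟨v, hv, e, he, rfl⟩ := Submodule.mem_sup.1 (hFle hu)
  have h1 := hS.neg_on v hv
  have h2 := (hS.mem_iff e).1 he
  have h3 := mul_nonneg hS.pos.le (form_nonneg h.posN v)
  simp only [map_add, LinearMap.add_apply, h2, h.symmG v e, h.symmQ v e]
  linarith

theorem exists_ge (hS : IsSplitting Q G N lam V E δ) (h : IsCompactPair Q G N θ)
    {F : Submodule ℝ H} (hF : Module.finrank ℝ V < Module.finrank ℝ F) :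
    ∃ u ∈ F, u ≠ 0 ∧ lam * Q u u ≤ G u u := by
  have := hS.finV
  have := hS.finE
  have hFfin : FiniteDimensional ℝ F := Module.finite_of_finrank_pos (by omega)
  obtain ⟨u, huF, hu0, hu⟩ := exists_ne_zero_mem_ker F (V.subtype.dualMap ∘ₗ (G - lam • Q))
    (by rwa [Subspace.dual_finrank_eq])
  have huV : ∀ v ∈ V, G v u = lam * Q v u := by
    intro v hv
    have h1 : G u v - lam * Q u v = 0 := LinearMap.congr_fun hu ⟨v, hv⟩
    rw [h.symmG v, h.symmQ v]
    linarith
  obtain ⟨x, hxE, hx⟩ := exists_orthogonal_projection Q h.symmQ E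
    (fun v _ hv0 => h.posQ v hv0) u
  have hxk := (hS.mem_iff x).1 hxE
  have h1 := hS.pos_on (u - x) (fun v hv => by
    rw [map_sub, map_sub, huV v hv, h.symmG v x, h.symmQ v x, hxk]
    ring) hx
  replace h1 := (mul_nonneg hS.pos.le (form_nonneg h.posN (u - x))).trans h1
  simp only [map_sub, LinearMap.sub_apply, hxk, h.symmG u x, h.symmQ u x] at h1
  exact ⟨u, huF, hu0, by linarith⟩

theorem exists_above (hS : IsSplitting Q G N lam V E δ) (h : IsCompactPair Q G N θ) :
    ∃ ε : ℝ, 0 < ε ∧ ∀ F : Submodule ℝ H,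
      Module.finrank ℝ V + Module.finrank ℝ E < Module.finrank ℝ F →
        ∃ u ∈ F, u ≠ 0 ∧ (lam + ε) * Q u u ≤ G u u := by
  have := hS.finV
  have := hS.finE
  obtain ⟨C, hC0, hC⟩ := h.exists_Q_le
  refine ⟨δ / C, div_pos hS.pos hC0, fun F hF => ?_⟩
  have hFfin : FiniteDimensional ℝ F := Module.finite_of_finrank_pos (by omega)
  obtain ⟨u, huF, hu0, hu⟩ := exists_ne_zero_mem_ker F
    ((V.subtype.dualMap ∘ₗ (G - lam • Q)).prod (E.subtype.dualMap ∘ₗ Q))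
    (by rwa [Module.finrank_prod, Subspace.dual_finrank_eq, Subspace.dual_finrank_eq])
  have hu1 : (V.subtype.dualMap ∘ₗ (G - lam • Q)) u = 0 := congrArg Prod.fst hu
  have hu2 : (E.subtype.dualMap ∘ₗ Q) u = 0 := congrArg Prod.snd hu
  have h1 := hS.pos_on u (fun v hv => by
    have h1 : G u v - lam * Q u v = 0 := LinearMap.congr_fun hu1 ⟨v, hv⟩
    rw [h.symmG v, h.symmQ v]
    linarith) (fun e he => (h.symmQ e u).trans (LinearMap.congr_fun hu2 ⟨e, he⟩))
  have h2 : δ / C * Q u u ≤ δ * N u u := by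
    rw [div_mul_eq_mul_div, div_le_iff₀ hC0]
    nlinarith [hC u, hS.pos]
  exact ⟨u, huF, hu0, by linarith⟩

end IsSplitting

variable {Y : Type*} [AddCommGroup Y] [Module ℝ Y]

theorem mem_grassmannian_range (ψ : H →ₗ[ℝ] Y) (hψ : Function.Injective ψ) {k : ℕ}
    {F : Submodule ℝ Y} : F ∈ grassmannian k (LinearMap.range ψ) ↔
      ∃ F' : Submodule ℝ H, Module.finrank ℝ F' = k ∧ F'.map ψ = F := by
  have hrank : ∀ F' : Submodule ℝ H, Module.finrank ℝ (F'.map ψ) = Module.finrank ℝ F' :=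
    fun F' => (LinearEquiv.finrank_eq (Submodule.equivMapOfInjective ψ hψ F')).symm
  constructor
  · rintro ⟨hF, hk⟩
    have h1 := Submodule.map_comap_eq_of_le hF
    exact ⟨F.comap ψ, by rw [← hrank, h1, hk], h1⟩
  · rintro ⟨F', hk, rfl⟩
    exact ⟨LinearMap.map_le_range, by rw [hrank, hk]⟩

/-- A min-max over subspaces is transported by an injective linear map. -/
theorem isMinMax_range (ψ : H →ₗ[ℝ] Y) (hψ : Function.Injective ψ) {k : ℕ} {f : Y → ℝ} {ℓ : ℝ}
    (h : IsMinMax (grassmannian k (⊤ : Submodule ℝ H)) (fun u => f (ψ u)) ℓ) :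
    IsMinMax (grassmannian k (LinearMap.range ψ)) f ℓ := by
  have himage : ∀ F' : Submodule ℝ H, f '' {u | u ∈ F'.map ψ ∧ u ≠ 0} =
      (fun u => f (ψ u)) '' {u | u ∈ F' ∧ u ≠ 0} := by
    intro F'
    ext r
    constructor
    · rintro ⟨_, ⟨⟨u, hu, rfl⟩, hu0⟩, rfl⟩
      exact ⟨u, ⟨hu, fun h0 => hu0 (by simp [h0])⟩, rfl⟩
    · rintro ⟨u, ⟨hu, hu0⟩, rfl⟩
      exact ⟨ψ u, ⟨⟨u, hu, rfl⟩, fun h0 => hu0 (hψ (by simpa using h0))⟩, rfl⟩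
  refine ⟨fun F hF => ?_, ?_, ?_⟩
  · obtain ⟨F', hk, rfl⟩ := (mem_grassmannian_range ψ hψ).1 hF
    rw [himage]
    exact h.1 F' ⟨le_top, hk⟩
  · obtain ⟨F', hF', hM⟩ := h.2.1
    exact ⟨F'.map ψ, (mem_grassmannian_range ψ hψ).2 ⟨F', hF'.2, rfl⟩, by rwa [himage]⟩
  · rintro M ⟨F, hF, hM⟩
    obtain ⟨F', hk, rfl⟩ := (mem_grassmannian_range ψ hψ).1 hF
    rw [himage] at hM
    exact h.2.2 ⟨F', ⟨le_top, hk⟩, hM⟩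

end Counting

/-! ### The forms of a Rayleigh family near a parameter -/

namespace RayleighFamily

open LinearMap (BilinForm)

variable {X Y : Type*} [NormedAddCommGroup X] [NormedSpace ℝ X] [AddCommGroup Y] [Module ℝ Y]
  {S : RayleighFamily X Y} {x : X}

/-- The form `B x'` restricted to the form domain at `x`. -/
noncomputable def qForm (S : RayleighFamily X Y) (x x' : X) : BilinForm ℝ (S.H x) :=
  (QuadraticMap.associated (R := ℝ) (S.Q x')).compl₁₂ (S.H x).subtype (S.H x).subtype

open Classical in
/-- The form `Γ x'` on the form domain at `x`; the value `0` is taken when the domain at `x'` does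
not contain the one at `x`, which never happens for `x'` near `x`. -/
noncomputable def gForm (S : RayleighFamily X Y) (x x' : X) : BilinForm ℝ (S.H x) :=
  if h : S.H x ≤ S.H x' then
    (QuadraticMap.associated (R := ℝ) (S.G x')).compl₁₂ (Submodule.inclusion h)
      (Submodule.inclusion h)
  else 0

/-- The form of the square of the norm `N θ x`. -/
noncomputable def nForm (S : RayleighFamily X Y) (θ : X → ℝ) (x : X) : BilinForm ℝ (S.H x) :=
  S.gForm x x + θ x • S.qForm x x

theorem qForm_apply (x' : X) (u v : S.H x) : S.qForm x x' u v = S.B x' u v := rfl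

theorem gForm_apply {x' : X} (h : S.H x ≤ S.H x') (u v : S.H x) :
    S.gForm x x' u v = S.Γ x' u v := by
  rw [gForm, dif_pos h, S.Γ_eq x' (h u.2) (h v.2)]
  rfl

theorem qForm_symm (x' : X) (u v : S.H x) : S.qForm x x' u v = S.qForm x x' v u :=
  QuadraticMap.associated_isSymm ℝ (S.Q x') u v

theorem gForm_symm (x' : X) (u v : S.H x) : S.gForm x x' u v = S.gForm x x' v u := by
  by_cases h : S.H x ≤ S.H x'
  · rw [gForm_apply h, gForm_apply h, Γ, Γ, add_comm (u : Y)]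
    ring
  · simp [gForm, h]

theorem B_self (x' : X) (u : Y) : S.B x' u u = S.Q x' u :=
  QuadraticMap.associated_eq_self_apply ℝ (S.Q x') u

theorem Γ_self {x' : X} {u : Y} (hu : u ∈ S.H x') : S.Γ x' u u = S.g x' u := by
  rw [S.Γ_eq x' hu hu, QuadraticMap.associated_eq_self_apply, g, dif_pos hu]

theorem qForm_self (x' : X) (u : S.H x) : S.qForm x x' u u = S.Q x' u := B_self (S := S) x' u

theorem gForm_self {x' : X} (h : S.H x ≤ S.H x') (u : S.H x) :
    S.gForm x x' u u = S.g x' u := by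
  rw [gForm_apply h, Γ_self (h u.2)]

theorem nForm_self (θ : X → ℝ) (u : S.H x) :
    S.nForm θ x u u = S.g x u + θ x * S.Q x u := by
  simp [nForm, gForm_self le_rfl, qForm_self]

theorem N_eq_sqrt_nForm (θ : X → ℝ) (u : S.H x) : S.N θ x u = √(S.nForm θ x u u) := by
  rw [nForm_self, N]

theorem nForm_pos {θ : X → ℝ} (h : S.HilbertAt θ x) {u : S.H x} (hu : u ≠ 0) :
    0 < S.nForm θ x u u := by
  obtain ⟨V, hV, -, -, h⟩ := h
  have h1 := (h x (mem_of_mem_nhds hV)).2.1 u hu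
  simpa [shiftedForm, nForm_self, g] using h1

theorem StandingAssumptions.isCompactPair (hS : S.StandingAssumptions) (hx : x ∈ S.Ω) {θ : X → ℝ}
    (hH : S.HilbertAt θ x) (hC : S.CompactAt θ x) :
    IsCompactPair (S.qForm x x) (S.gForm x x) (S.nForm θ x) (θ x) where
  symmQ := qForm_symm x
  symmG := gForm_symm x
  posQ u hu := by
    rw [qForm_self]
    exact (hS.forms x hx).1 u (by simpa using hu)
  N_eq u v := by simp [nForm]
  posN u hu := nForm_pos hH hu
  compact u := by
    rintro ⟨M, hM⟩
    obtain ⟨v, hv, φ, hφ, h1, h2⟩ := hC (fun _ => x) (fun k => u k) (fun _ => hx)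
      tendsto_const_nhds (fun k => (u k).2)
      ⟨√M, fun k => by
        rw [N_eq_sqrt_nForm]
        exact Real.sqrt_le_sqrt (hM k)⟩
    refine ⟨⟨v, hv⟩, φ, hφ, ?_, fun w => ?_⟩
    · simp only [qForm_self, Submodule.coe_sub]
      exact h1
    · simpa only [gForm_apply le_rfl] using h2 w w.2

/-! ### Bounds for the eigenvalues by test spaces -/

theorem StandingAssumptions.exists_lower_bound (hS : S.StandingAssumptions) (hx : x ∈ S.Ω) :
    ∃ c : ℝ, ∀ u ∈ S.H x, c * S.Q x u ≤ S.g x u := by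
  obtain ⟨θ, hH, -⟩ := hS.shift x hx
  refine ⟨-θ x, fun u hu => ?_⟩
  have := form_nonneg (fun u hu => nForm_pos hH hu) (⟨u, hu⟩ : S.H x)
  rw [nForm_self] at this
  linarith

theorem exists_mem_grassmannian {x' : X} (hH : S.H x' = S.H x) {k : ℕ} {F : Submodule ℝ Y} :
    F ∈ grassmannian k (S.H x') ↔
      ∃ F' : Submodule ℝ (S.H x), Module.finrank ℝ F' = k ∧ F'.map (S.H x).subtype = F := by
  rw [hH, ← mem_grassmannian_range _ (S.H x).injective_subtype, Submodule.range_subtype]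

theorem rayleigh_image_nonempty (hQ : (S.Q x).PosDef) {k : ℕ} (hk : 1 ≤ k)
    {F : Submodule ℝ Y} (hF : Module.finrank ℝ F = k) :
    (S.rayleigh x '' {u | u ∈ F ∧ S.Q x u = 1}).Nonempty := by
  have : Nontrivial F := Module.nontrivial_of_finrank_pos (R := ℝ) (by omega)
  obtain ⟨u, hu⟩ := exists_ne (0 : F)
  have h1 := hQ u (by simpa using hu)
  refine Set.Nonempty.image _ ⟨(√(S.Q x u))⁻¹ • (u : Y), F.smul_mem _ u.2, ?_⟩
  rw [QuadraticMap.map_smul, smul_eq_mul, ← mul_inv, Real.mul_self_sqrt h1.le,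
    inv_mul_cancel₀ h1.ne']

theorem rayleigh_image_bddAbove (hQ : (S.Q x).PosDef) {k : ℕ} (hk : 1 ≤ k)
    {F : Submodule ℝ Y} (hF : F ∈ grassmannian k (S.H x)) :
    BddAbove (S.rayleigh x '' {u | u ∈ F ∧ S.Q x u = 1}) := by
  obtain ⟨F', hF', rfl⟩ := (exists_mem_grassmannian rfl).1 hF
  have hpos : ∀ u : S.H x, u ≠ 0 → 0 < S.qForm x x u u := fun u hu => by
    rw [qForm_self]
    exact hQ u (by simpa using hu)
  obtain ⟨c, hc⟩ := exists_form_le (qForm_symm x) hpos (gForm_symm x) F' (by omega)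
  refine ⟨c, ?_⟩
  rintro _ ⟨_, ⟨⟨v, hv, rfl⟩, hv1⟩, rfl⟩
  have h1 := hc v hv
  rw [Submodule.subtype_apply] at hv1
  rw [gForm_self le_rfl v, qForm_self x v, hv1, mul_one] at h1
  rw [Submodule.subtype_apply, rayleigh, hv1, div_one]
  exact h1

/-- A test space on which the Rayleigh quotient is at most `c` bounds the eigenvalue from above. -/
theorem StandingAssumptions.eigenvalue_le (hS : S.StandingAssumptions) (hx : x ∈ S.Ω) {k : ℕ}
    (hk : 1 ≤ k) {c : ℝ} {F : Submodule ℝ Y} (hF : F ∈ grassmannian k (S.H x))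
    (hc : ∀ u ∈ F, S.g x u ≤ c * S.Q x u) : S.eigenvalue k x ≤ c := by
  have hQ := (hS.forms x hx).1
  obtain ⟨c₀, hc₀⟩ := hS.exists_lower_bound hx
  rw [eigenvalue]
  refine (csInf_le ?_ (Set.mem_image_of_mem _ hF)).trans
    (csSup_le (rayleigh_image_nonempty hQ hk hF.2) ?_)
  · refine ⟨c₀, ?_⟩
    rintro _ ⟨F', hF', rfl⟩
    obtain ⟨_, u, hu, rfl⟩ := rayleigh_image_nonempty hQ hk hF'.2
    refine le_trans ?_ (le_csSup (rayleigh_image_bddAbove hQ hk hF') ⟨u, hu, rfl⟩)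
    rw [rayleigh, hu.2, div_one]
    simpa [hu.2] using hc₀ u (hF'.1 hu.1)
  · rintro _ ⟨u, hu, rfl⟩
    rw [rayleigh, hu.2, div_one]
    simpa [hu.2] using hc u hu.1

/-- If every test space contains a vector with Rayleigh quotient at least `c`, then the eigenvalue
is at least `c`. -/
theorem StandingAssumptions.le_eigenvalue (hS : S.StandingAssumptions) (hx : x ∈ S.Ω) {k : ℕ}
    (hk : 1 ≤ k) {c : ℝ} (hne : (grassmannian k (S.H x)).Nonempty)
    (hc : ∀ F ∈ grassmannian k (S.H x), ∃ u ∈ F, u ≠ 0 ∧ c * S.Q x u ≤ S.g x u) :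
    c ≤ S.eigenvalue k x := by
  have hQ := (hS.forms x hx).1
  refine le_csInf (hne.image _) ?_
  rintro _ ⟨F, hF, rfl⟩
  obtain ⟨u, huF, hu0, hu⟩ := hc F hF
  have h1 := hQ u hu0
  have hg : ∀ a : ℝ, S.g x (a • u) = a * a * S.g x u := by
    intro a
    have huH := hF.1 huF
    have haH := (S.H x).smul_mem a huH
    rw [g, g, dif_pos huH, dif_pos haH]
    exact QuadraticMap.map_smul (S.G x) a ⟨u, huH⟩
  have hnorm : S.Q x ((√(S.Q x u))⁻¹ • u) = 1 := by
    rw [QuadraticMap.map_smul, smul_eq_mul, ← mul_inv, Real.mul_self_sqrt h1.le,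
      inv_mul_cancel₀ h1.ne']
  refine le_trans ?_ (le_csSup (rayleigh_image_bddAbove hQ hk hF)
    ⟨_, ⟨F.smul_mem (√(S.Q x u))⁻¹ huF, hnorm⟩, rfl⟩)
  rw [rayleigh, hnorm, div_one, hg, ← mul_inv, Real.mul_self_sqrt h1.le, inv_mul_eq_div,
    le_div_iff₀ h1]
  exact hu

variable {θ : X → ℝ} {lam δ : ℝ} {V E : Submodule ℝ (S.H x)}

theorem StandingAssumptions.eigenvalue_le_of_form (hS : S.StandingAssumptions) {x' : X}
    (hx' : x' ∈ S.Ω) (hH : S.H x' = S.H x) {k : ℕ} (hk : 1 ≤ k) {c : ℝ}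
    {F : Submodule ℝ (S.H x)} (hF : Module.finrank ℝ F = k)
    (hc : ∀ u ∈ F, S.gForm x x' u u ≤ c * S.qForm x x' u u) : S.eigenvalue k x' ≤ c := by
  refine hS.eigenvalue_le hx' hk ((exists_mem_grassmannian hH).2 ⟨F, hF, rfl⟩) ?_
  rintro _ ⟨u, hu, rfl⟩
  have := hc u hu
  rwa [gForm_self hH.ge, qForm_self] at this

theorem StandingAssumptions.le_eigenvalue_of_form (hS : S.StandingAssumptions) {x' : X}
    (hx' : x' ∈ S.Ω) (hH : S.H x' = S.H x) {k : ℕ} (hk : 1 ≤ k) {c : ℝ}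
    (hne : (grassmannian k (S.H x)).Nonempty)
    (hc : ∀ F : Submodule ℝ (S.H x), Module.finrank ℝ F = k →
      ∃ u ∈ F, u ≠ 0 ∧ c * S.qForm x x' u u ≤ S.gForm x x' u u) : c ≤ S.eigenvalue k x' := by
  refine hS.le_eigenvalue hx' hk (by rwa [hH]) fun F hF => ?_
  obtain ⟨F, hFk, rfl⟩ := (exists_mem_grassmannian hH).1 hF
  obtain ⟨u, hu, hu0, h⟩ := hc F hFk
  rw [gForm_self hH.ge, qForm_self] at h
  exact ⟨u, ⟨u, hu, rfl⟩, by simpa using hu0, h⟩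

/-- The indices of the cluster of `λ_k(x)` are those between `dim V + 1` and `dim V + dim E`. -/
theorem StandingAssumptions.cluster_eq (hS : S.StandingAssumptions) (hx : x ∈ S.Ω) {k : ℕ}
    (h : IsCompactPair (S.qForm x x) (S.gForm x x) (S.nForm θ x) (θ x))
    (hsp : IsSplitting (S.qForm x x) (S.gForm x x) (S.nForm θ x) (S.eigenvalue k x) V E δ) :
    S.cluster k x = Set.Icc (Module.finrank ℝ V + 1)
      (Module.finrank ℝ V + Module.finrank ℝ E) := by
  ext j
  constructor
  · rintro ⟨hj1, hne, hj⟩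
    refine ⟨?_, ?_⟩
    · by_contra! hlt
      obtain ⟨ε, hε, F, hF, hle⟩ := hsp.exists_below h (j := j) (by omega)
      have := hS.eigenvalue_le_of_form hx rfl hj1 hF hle
      linarith
    · by_contra! hlt
      obtain ⟨ε, hε, hge⟩ := hsp.exists_above h
      have := hS.le_eigenvalue_of_form hx rfl hj1 hne fun F hF => hge F (by omega)
      linarith
  · rintro ⟨hj1, hj2⟩
    obtain ⟨F, hF, hle⟩ := hsp.exists_le h hj2
    have hne : (grassmannian j (S.H x)).Nonempty :=
      ⟨_, (exists_mem_grassmannian rfl).2 ⟨F, hF, rfl⟩⟩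
    refine ⟨by omega, hne, le_antisymm (hS.eigenvalue_le_of_form hx rfl (by omega) hF hle) ?_⟩
    exact hS.le_eigenvalue_of_form hx rfl (by omega) hne fun F hF =>
      hsp.exists_ge h (by omega)

theorem map_kernel_eq_eigenspace {k : ℕ}
    (hsp : IsSplitting (S.qForm x x) (S.gForm x x) (S.nForm θ x) (S.eigenvalue k x) V E δ) :
    E.map (S.H x).subtype = S.eigenspace k x := by
  have hB : ∀ (u v : Y), S.B x (S.eigenvalue k x • u) v = S.eigenvalue k x * S.B x u v := by
    intro u v
    simp [B]
  ext u
  constructor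
  · rintro ⟨u, hu, rfl⟩
    refine ⟨u.2, fun v hv => ?_⟩
    have := (hsp.mem_iff u).1 hu ⟨v, hv⟩
    rw [gForm_apply le_rfl, qForm_apply] at this
    rw [hB]
    exact this
  · rintro ⟨hu, hΓ⟩
    refine ⟨⟨u, hu⟩, (hsp.mem_iff _).2 fun v => ?_, rfl⟩
    rw [gForm_apply le_rfl, qForm_apply, hΓ v v.2, hB]

end RayleighFamily

/-! ### Differentiability of the forms in the parameter -/

namespace RayleighFamily

open LinearMap (BilinForm)

variable {X Y : Type*} [NormedAddCommGroup X] [NormedSpace ℝ X] [AddCommGroup Y] [Module ℝ Y]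
  {S : RayleighFamily X Y} {x : X} {θ : X → ℝ}

theorem NormsEquivalentAt.eventually_domain (h : S.NormsEquivalentAt θ x) :
    ∀ᶠ x' in 𝓝 x, x' ∈ S.Ω ∧ S.H x' = S.H x := by
  obtain ⟨C, -, V, hV, hVΩ, h⟩ := h
  filter_upwards [hV] with x' hx'
  exact ⟨hVΩ hx', (h x' hx').1⟩

theorem B_eq (x' : X) (u v : Y) :
    S.B x' u v = (S.Q x' (u + v) - S.Q x' u - S.Q x' v) / 2 := by
  rw [B, QuadraticMap.associated_apply, Module.End.smul_def]
  simp
  ring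

theorem DifferentiableFormsAt.B (h : S.DifferentiableFormsAt x) (u v : Y) :
    DifferentiableAt ℝ (fun y => S.B y u v) x := by
  simp only [B_eq, div_eq_mul_inv]
  exact (((h.1 (u + v)).fun_sub (h.1 u)).fun_sub (h.1 v)).mul_const (2 : ℝ)⁻¹

theorem DifferentiableFormsAt.Γ (h : S.DifferentiableFormsAt x) {u v : Y} (hu : u ∈ S.H x)
    (hv : v ∈ S.H x) : DifferentiableAt ℝ (fun y => S.Γ y u v) x := by
  simp only [RayleighFamily.Γ, div_eq_mul_inv]
  exact (((h.2 (u + v) (add_mem hu hv)).fun_sub (h.2 u hu)).fun_sub (h.2 v hv)).mul_const (2 : ℝ)⁻¹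

theorem Bx_eq_fderiv (u v : S.H x) : S.Bx x u v = fderiv ℝ (fun y => S.qForm x y u v) x := rfl

theorem Γx_eq_fderiv (hN : S.NormsEquivalentAt θ x) (u v : S.H x) :
    S.Γx x u v = fderiv ℝ (fun y => S.gForm x y u v) x :=
  Filter.EventuallyEq.fderiv_eq <| hN.eventually_domain.mono fun _ hy =>
    (gForm_apply hy.2.ge u v).symm

theorem DifferentiableFormsAt.gForm (hD : S.DifferentiableFormsAt x)
    (hN : S.NormsEquivalentAt θ x) (u v : S.H x) :
    DifferentiableAt ℝ (fun y => S.gForm x y u v) x :=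
  (hD.Γ u.2 v.2).congr_of_eventuallyEq <|
    hN.eventually_domain.mono fun _ hy => gForm_apply hy.2.ge u v

/-- The form `⟨Γx(x,u,v) - λ_k(x) Bx(x,u,v), h⟩` is bilinear on the form domain. -/
noncomputable def derivBilinForm (hD : S.DifferentiableFormsAt x) (hN : S.NormsEquivalentAt θ x)
    (k : ℕ) (h : X) : BilinForm ℝ (S.H x) :=
  have hq : ∀ u v : S.H x, DifferentiableAt ℝ (fun y => S.qForm x y u v) x := fun u v => hD.B u v
  LinearMap.mk₂ ℝ (fun u v => S.derivForm k x h u v)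
    (fun u u' v => by
      simp only [derivForm, Bx_eq_fderiv, Γx_eq_fderiv hN, map_add, LinearMap.add_apply]
      rw [fderiv_fun_add (hD.gForm hN u v) (hD.gForm hN u' v), fderiv_fun_add (hq u v) (hq u' v)]
      simp only [sub_apply, smul_apply,
        add_apply, smul_eq_mul]
      ring)
    (fun c u v => by
      simp only [derivForm, Bx_eq_fderiv, Γx_eq_fderiv hN, map_smul, LinearMap.smul_apply]
      rw [fderiv_fun_const_smul (hD.gForm hN u v), fderiv_fun_const_smul (hq u v)]
      simp only [sub_apply, smul_apply, smul_eq_mul]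
      ring)
    (fun u v v' => by
      simp only [derivForm, Bx_eq_fderiv, Γx_eq_fderiv hN, map_add]
      rw [fderiv_fun_add (hD.gForm hN u v) (hD.gForm hN u v'), fderiv_fun_add (hq u v) (hq u v')]
      simp only [sub_apply, smul_apply,
        add_apply, smul_eq_mul]
      ring)
    (fun c u v => by
      simp only [derivForm, Bx_eq_fderiv, Γx_eq_fderiv hN, map_smul]
      rw [fderiv_fun_const_smul (hD.gForm hN u v), fderiv_fun_const_smul (hq u v)]
      simp only [sub_apply, smul_apply, smul_eq_mul]
      ring)

theorem derivBilinForm_apply (hD : S.DifferentiableFormsAt x) (hN : S.NormsEquivalentAt θ x)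
    (k : ℕ) (h : X) (u v : S.H x) :
    derivBilinForm hD hN k h u v = S.derivForm k x h u v := rfl

theorem derivBilinForm_symm (hD : S.DifferentiableFormsAt x) (hN : S.NormsEquivalentAt θ x)
    (k : ℕ) (h : X) (u v : S.H x) :
    derivBilinForm hD hN k h u v = derivBilinForm hD hN k h v u := by
  simp only [derivBilinForm_apply, derivForm, Bx_eq_fderiv, Γx_eq_fderiv hN, qForm_symm _ u v,
    gForm_symm _ u v]

/-- On the eigenspace the derivative of the Rayleigh quotient is the Rayleigh quotient of the
derivative form. -/
theorem rayleighx_eq (hD : S.DifferentiableFormsAt x) (hN : S.NormsEquivalentAt θ x)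
    {k : ℕ} {u : S.H x} (hu : S.gForm x x u u = S.eigenvalue k x * S.qForm x x u u)
    (hpos : 0 < S.qForm x x u u) (h : X) :
    S.rayleighx x u h = derivBilinForm hD hN k h u u / S.qForm x x u u := by
  have hq : HasFDerivAt (fun y => S.qForm x y u u) (S.Bx x u u) x := (hD.B u u).hasFDerivAt
  have hg : HasFDerivAt (fun y => S.gForm x y u u) (S.Γx x u u) x := by
    rw [Γx_eq_fderiv hN]
    exact (hD.gForm hN u u).hasFDerivAt
  have hev : (fun y => S.rayleigh y u) =ᶠ[𝓝 x] fun y => S.gForm x y u u / S.qForm x y u u :=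
    hN.eventually_domain.mono fun y hy => by
      simp only [rayleigh, gForm_self hy.2.ge, qForm_self]
  have hinv : HasFDerivAt (fun y => (S.qForm x y u u)⁻¹) _ x :=
    (hasDerivAt_inv hpos.ne').comp_hasFDerivAt x hq
  simp only [div_eq_mul_inv (S.gForm x _ u u)] at hev
  rw [rayleighx, hev.fderiv_eq, (hg.fun_mul hinv).fderiv, derivBilinForm_apply, derivForm]
  simp only [sub_apply, add_apply, smul_apply, smul_eq_mul]
  rw [hu]
  field_simp
  ring

/-- The bounds on the derivatives and the mean value inequality make the forms Lipschitz at `x`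
with respect to `N θ x`. -/
theorem StandingAssumptions.exists_lipschitz (hS : S.StandingAssumptions)
    (hN : S.NormsEquivalentAt θ x) (hB : S.DerivBoundsAt θ x) :
    ∃ K : ℝ, 0 ≤ K ∧ ∀ᶠ x' in 𝓝 x, ∀ u v : S.H x,
      |S.qForm x x' u v - S.qForm x x u v| ≤
          K * ‖x' - x‖ * (√(S.nForm θ x u u) * √(S.nForm θ x v v)) ∧
        |S.gForm x x' u v - S.gForm x x u v| ≤
          K * ‖x' - x‖ * (√(S.nForm θ x u u) * √(S.nForm θ x v v)) := by
  obtain ⟨C, hC1, V, hV, hVΩ, hC⟩ := hN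
  obtain ⟨C₀, hC₀, V', hV', -, hb⟩ := hB
  obtain ⟨r, hr, hball⟩ := Metric.mem_nhds_iff.1 (inter_mem hV hV')
  have hC0 : 0 < C := by linarith
  have hbound : ∀ y ∈ Metric.ball x r, ∀ u v : S.H x, C₀ * S.N θ y u * S.N θ y v ≤
      C₀ * C ^ 2 * (√(S.nForm θ x u u) * √(S.nForm θ x v v)) := by
    intro y hy u v
    have h1 : ∀ u : S.H x, S.N θ y u ≤ C * √(S.nForm θ x u u) := fun u => by
      rw [← N_eq_sqrt_nForm, ← inv_mul_le_iff₀ hC0]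
      exact ((hC y (hball hy).1).2 u u.2).1
    calc C₀ * S.N θ y u * S.N θ y v = C₀ * (S.N θ y u * S.N θ y v) := by ring
      _ ≤ C₀ * ((C * √(S.nForm θ x u u)) * (C * √(S.nForm θ x v v))) :=
          mul_le_mul_of_nonneg_left
            (mul_le_mul (h1 u) (h1 v) (Real.sqrt_nonneg _) (by positivity)) hC₀.le
      _ = _ := by ring
  refine ⟨C₀ * C ^ 2, by positivity, ?_⟩
  filter_upwards [Metric.ball_mem_nhds x hr] with x' hx' u v
  have hdiff : ∀ y ∈ Metric.ball x r, S.DifferentiableFormsAt y := fun y hy =>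
    hS.differentiable y (hVΩ (hball hy).1)
  have hdom : ∀ y ∈ Metric.ball x r, S.H y = S.H x := fun y hy => (hC y (hball hy).1).1
  have hx := Metric.mem_ball_self (x := x) hr
  constructor
  · have h1 := (convex_ball x r).norm_image_sub_le_of_norm_fderiv_le (𝕜 := ℝ)
      (f := fun y => S.B y u v) (fun y hy => (hdiff y hy).B u v)
      (fun y hy => ((hb y (hball hy).2 u u.2 v v.2).1).trans (hbound y hy u v)) hx hx'
    rw [Real.norm_eq_abs] at h1
    exact h1.trans_eq (by ring)
  · have h1 := (convex_ball x r).norm_image_sub_le_of_norm_fderiv_le (𝕜 := ℝ)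
      (f := fun y => S.Γ y u v)
      (fun y hy => (hdiff y hy).Γ (by rw [hdom y hy]; exact u.2) (by rw [hdom y hy]; exact v.2))
      (fun y hy => ((hb y (hball hy).2 u u.2 v v.2).2).trans (hbound y hy u v)) hx hx'
    rw [Real.norm_eq_abs] at h1
    rw [gForm_apply (hdom x' hx').ge, gForm_apply le_rfl]
    exact h1.trans_eq (by ring)

/-- Along a family of parameters tangent to `h`, the forms are a first-order perturbation. -/
theorem StandingAssumptions.isFirstOrderPerturbation (hS : S.StandingAssumptions)
    (hD : S.DifferentiableFormsAt x) (hN : S.NormsEquivalentAt θ x) (hB : S.DerivBoundsAt θ x)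
    {k : ℕ} {E : Submodule ℝ (S.H x)}
    (hE : ∀ e ∈ E, ∀ u, S.gForm x x e u = S.eigenvalue k x * S.qForm x x e u)
    {ι : Type*} {l : Filter ι} {t : ι → ℝ} {xs : ι → X} {h : X} (ht0 : ∀ᶠ i in l, 0 < t i)
    (ht : Tendsto t l (𝓝 0)) (hlim : Tendsto (fun i => (t i)⁻¹ • (xs i - x)) l (𝓝 h)) :
    ∃ K, IsFirstOrderPerturbation l t (S.qForm x x) (S.gForm x x) (S.nForm θ x)
      (derivBilinForm hD hN k h) (fun i => S.qForm x (xs i)) (fun i => S.gForm x (xs i))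
      (S.eigenvalue k x) E K := by
  obtain ⟨K, hK0, hK⟩ := hS.exists_lipschitz hN hB
  have hd : Tendsto (fun i => xs i - x) l (𝓝 0) := by
    have := ht.smul hlim
    rw [zero_smul] at this
    refine this.congr' ?_
    filter_upwards [ht0] with i hi
    rw [smul_inv_smul₀ hi.ne']
  have hxs : Tendsto xs l (𝓝 x) := by simpa using hd.add_const x
  have hnorm : ∀ᶠ i in l, ‖xs i - x‖ ≤ (‖h‖ + 1) * t i := by
    filter_upwards [ht0, hlim.norm.eventually (gt_mem_nhds (lt_add_one ‖h‖))] with i hi h1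
    rw [norm_smul, norm_inv, Real.norm_of_nonneg hi.le, inv_mul_lt_iff₀ hi] at h1
    linarith
  have hmono : ∀ᶠ i in l, ∀ s : ℝ, 0 ≤ s → K * ‖xs i - x‖ * s ≤ K * (‖h‖ + 1) * t i * s := by
    filter_upwards [hnorm] with i hi s hs
    rw [mul_assoc K (‖h‖ + 1)]
    gcongr
  refine ⟨K * (‖h‖ + 1), ht0, ht, fun i => qForm_symm _, fun i => gForm_symm _,
    derivBilinForm_symm hD hN k h, ?_, ?_, fun e he e' he' => ?_⟩
  · filter_upwards [hxs.eventually hK, hmono] with i h1 h2 u v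
    exact (h1 u v).1.trans (h2 _ (by positivity))
  · filter_upwards [hxs.eventually hK, hmono] with i h1 h2 u v
    exact (h1 u v).2.trans (h2 _ (by positivity))
  · have hq : HasFDerivAt (fun y => S.qForm x y e e') (S.Bx x e e') x :=
      (hD.B e e').hasFDerivAt
    have hg : HasFDerivAt (fun y => S.gForm x y e e') (S.Γx x e e') x := by
      rw [Γx_eq_fderiv hN]
      exact (hD.gForm hN e e').hasFDerivAt
    have h1 := (hasFDerivWithinAt_univ.2
      (hg.fun_sub (hq.const_mul (S.eigenvalue k x)))).lim (l := l) hd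
      (Eventually.of_forall fun _ => Set.mem_univ _) hlim
    refine h1.congr fun i => ?_
    rw [add_sub_cancel, hE e he e', smul_eq_mul]
    ring

/-- The eigenvalues of the cluster of `λ_k(x)` have one-sided derivatives, namely the ordered
eigenvalues of the derivative form on the eigenspace. -/
theorem StandingAssumptions.tendsto_eigenvalue_quotient (hS : S.StandingAssumptions)
    (hD : S.DifferentiableFormsAt x) (hN : S.NormsEquivalentAt θ x)
    (hB : S.DerivBoundsAt θ x) {k : ℕ} {V E : Submodule ℝ (S.H x)} {δ : ℝ}
    (hc : IsCompactPair (S.qForm x x) (S.gForm x x) (S.nForm θ x) (θ x))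
    (hsp : IsSplitting (S.qForm x x) (S.gForm x x) (S.nForm θ x) (S.eigenvalue k x) V E δ)
    {h : X} {m : ℕ} (e : Module.Basis (Fin m) ℝ E)
    (hQe : ∀ i j, S.qForm x x (e i) (e j) = if i = j then 1 else 0)
    (hDe : ∀ i j, i ≠ j → derivBilinForm hD hN k h (e i) (e j) = 0)
    (hmono : Monotone fun i => derivBilinForm hD hN k h (e i) (e i)) (j : Fin m)
    {ι : Type*} {l : Filter ι} {t : ι → ℝ} {xs : ι → X} (ht0 : ∀ᶠ i in l, 0 < t i)
    (ht : Tendsto t l (𝓝 0)) (hlim : Tendsto (fun i => (t i)⁻¹ • (xs i - x)) l (𝓝 h)) :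
    Tendsto (fun i => (S.eigenvalue (Module.finrank ℝ V + 1 + j) (xs i) - S.eigenvalue k x) / t i)
      l (𝓝 (derivBilinForm hD hN k h (e j) (e j))) := by
  obtain ⟨K, hP⟩ := hS.isFirstOrderPerturbation hD hN hB
    (fun e he => (hsp.mem_iff e).1 he) ht0 ht hlim
  have hxs : Tendsto xs l (𝓝 x) := by
    have := (ht.smul hlim).add_const x
    rw [zero_smul, zero_add] at this
    refine this.congr' ?_
    filter_upwards [ht0] with i hi
    rw [smul_inv_smul₀ hi.ne', sub_add_cancel]
  have hdom := hxs.eventually hN.eventually_domain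
  refine tendsto_order.2 ⟨fun a ha => ?_, fun a ha => ?_⟩
  · obtain ⟨c, hac, hc'⟩ := exists_between ha
    obtain ⟨F, hF, -⟩ := hP.eventually_exists_upper hc hsp e hQe hDe hmono j (lt_add_one _)
    filter_upwards [hP.eventually_forall_lower hc hsp e hQe hDe hmono j hc', hdom, ht0]
      with i hi hd hti
    have := hS.le_eigenvalue_of_form hd.1 hd.2 (by omega)
      ⟨_, (exists_mem_grassmannian rfl).2 ⟨F, hF, rfl⟩⟩ hi
    rw [lt_div_iff₀ hti]
    nlinarith
  · obtain ⟨c, hc', hca⟩ := exists_between ha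
    obtain ⟨F, hF, hev⟩ := hP.eventually_exists_upper hc hsp e hQe hDe hmono j hc'
    filter_upwards [hev, hdom, ht0] with i hi hd hti
    have := hS.eigenvalue_le_of_form hd.1 hd.2 (by omega) hF hi
    rw [div_lt_iff₀ hti]
    nlinarith

end RayleighFamily

/-! ### Directional derivatives of the eigenvalues -/

theorem theorem3p5 {X Y : Type*} [NormedAddCommGroup X] [NormedSpace ℝ X] [CompleteSpace X]
    [AddCommGroup Y] [Module ℝ Y] (S : RayleighFamily X Y) (hS : S.StandingAssumptions)
    (k : ℕ) (hk : 1 ≤ k) (x : X) (hx : x ∈ S.Ω) (hkH : (grassmannian k (S.H x)).Nonempty)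
    (h : X) :
    (∀ (t : ℕ → ℝ) (z : ℕ → X), (∀ n, 0 < t n) → Tendsto t atTop (𝓝 0) → z =o[atTop] t →
      ∃ φ : ℕ → ℕ, StrictMono φ ∧
      ∃ u : Fin (S.multiplicity k x) → Y,
        (∀ j, u j ∈ S.eigenspace k x) ∧
        (∀ i j, S.B x (u i) (u j) = if i = j then 1 else 0) ∧
        (∀ i j, i ≠ j → S.Γ x (u i) (u j) = 0) ∧
        (∀ i j, i ≠ j → S.derivForm k x h (u i) (u j) = 0) ∧
        ∀ j : Fin (S.multiplicity k x),
          Tendsto (fun n =>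
            (S.eigenvalue (S.firstIndex k x + (j : ℕ)) (x + t (φ n) • h + z (φ n))
              - S.eigenvalue (S.firstIndex k x + (j : ℕ)) x) / t (φ n))
            atTop (𝓝 (S.rayleighx x (u j) h))) ∧
    ∃ ℓ : ℝ,
      IsMinMax (grassmannian (S.position k x) (S.eigenspace k x))
        (fun u => S.rayleighx x u h) ℓ ∧
      (∀ y : ℝ → X, y 0 = x → HasDerivAt y h 0 →
        Tendsto (fun s : ℝ => (S.eigenvalue k (y s) - S.eigenvalue k x) / s) (𝓝[>] 0) (𝓝 ℓ)) ∧
      HasRightDirDeriv (S.eigenvalue k) x h ℓ := by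
  obtain ⟨θ, hH, hN, hC, -, hB⟩ := hS.shift x hx
  have hD := hS.differentiable x hx
  have hc := hS.isCompactPair hx hH hC
  obtain ⟨V, E, δ, hsp⟩ := hc.exists_isSplitting (S.eigenvalue k x)
  have hcl := hS.cluster_eq hx hc hsp
  have hkcl : k ∈ S.cluster k x := ⟨hk, hkH, rfl⟩
  rw [hcl, Set.mem_Icc] at hkcl
  have hmult : S.multiplicity k x = Module.finrank ℝ E := by
    rw [RayleighFamily.multiplicity, hcl, Set.ncard_Icc_nat]
    omega
  have hfirst : S.firstIndex k x = Module.finrank ℝ V + 1 := by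
    rw [RayleighFamily.firstIndex, hcl]
    exact csInf_Icc (hkcl.1.trans hkcl.2)
  have hfin := hsp.finE
  set D := RayleighFamily.derivBilinForm hD hN k h
  obtain ⟨e, hQe, hDe, hmono⟩ := exists_diagonalizing_basis hmult.symm
    ((S.qForm x x).restrict E) (D.restrict E) (fun u v => hc.symmQ u v)
    (fun u hu => hc.posQ u (by simpa using hu))
    (fun u v => RayleighFamily.derivBilinForm_symm hD hN k h u v)
  have hlimit : ∀ (j : Fin (S.multiplicity k x)) {ι : Type} {l : Filter ι} {t : ι → ℝ}
      {xs : ι → X}, (∀ᶠ i in l, 0 < t i) → Tendsto t l (𝓝 0) →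
      Tendsto (fun i => (t i)⁻¹ • (xs i - x)) l (𝓝 h) →
      Tendsto (fun i => (S.eigenvalue (S.firstIndex k x + j) (xs i) - S.eigenvalue k x) / t i) l
        (𝓝 (D (e j) (e j))) := by
    intro j ι l t xs h0 h1 h2
    rw [hfirst]
    exact hS.tendsto_eigenvalue_quotient hD hN hB hc hsp e hQe hDe hmono j h0 h1 h2
  have hray : ∀ u : E, u ≠ 0 →
      S.rayleighx x (u : S.H x) h = D u u / S.qForm x x u u := fun u hu =>
    RayleighFamily.rayleighx_eq hD hN ((hsp.mem_iff u).1 u.2 u) (hc.posQ u (by simpa using hu)) h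
  have hQe' : ∀ i j, S.qForm x x (e i) (e j) = if i = j then 1 else 0 := hQe
  -- The whole sequence of difference quotients converges, so the subsequence is the identity.
  refine ⟨fun t z ht0 ht hz => ⟨id, strictMono_id, fun j => ((e j : S.H x) : Y), fun j => ?_,
    hQe, fun i j hij => ?_, hDe, fun j => ?_⟩, ?_⟩
  · rw [← RayleighFamily.map_kernel_eq_eigenspace hsp]
    exact ⟨e j, (e j).2, rfl⟩
  · rw [← RayleighFamily.gForm_apply le_rfl, (hsp.mem_iff _).1 (e i).2, hQe', if_neg hij, mul_zero]
  · have hj : S.eigenvalue (S.firstIndex k x + j) x = S.eigenvalue k x := by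
      have hmem : S.firstIndex k x + j ∈ S.cluster k x := by
        rw [hcl, hfirst, Set.mem_Icc]
        omega
      exact hmem.2.2
    rw [hray _ (e.ne_zero j), hQe', if_pos rfl, div_one, hj]
    refine hlimit j (Eventually.of_forall ht0) ht ?_
    have hz' := (tendsto_const_nhds (x := h)).add hz.tendsto_inv_smul_nhds_zero
    rw [add_zero] at hz'
    refine hz'.congr fun n => ?_
    rw [id, add_assoc, add_sub_cancel_left, smul_add, inv_smul_smul₀ (ht0 n).ne']
  · obtain ⟨j, hj⟩ : ∃ j : Fin (S.multiplicity k x), S.firstIndex k x + j = k :=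
      ⟨⟨k - S.firstIndex k x, by omega⟩, by simp only; omega⟩
    have hcurve : ∀ y : ℝ → X, y 0 = x → HasDerivAt y h 0 →
        Tendsto (fun s : ℝ => (S.eigenvalue k (y s) - S.eigenvalue k x) / s) (𝓝[>] 0)
          (𝓝 (D (e j) (e j))) := by
      intro y hy0 hy
      have h1 := hlimit j (l := 𝓝[>] (0 : ℝ)) (t := fun s => s) (xs := y) self_mem_nhdsWithin
        nhdsWithin_le_nhds ?_
      · rwa [hj] at h1
      · have h2 := (hasDerivAt_iff_tendsto_slope.1 hy).mono_left
          (nhdsWithin_mono (s := Set.Ioi 0) 0 fun s hs => ne_of_gt (Set.mem_Ioi.1 hs))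
        simpa [slope_fun_def, hy0] using h2
    refine ⟨D (e j) (e j), ?_, hcurve, hcurve (fun s => x + s • h) (by simp) ?_⟩
    · have hpos : S.position k x = j + 1 := by
        rw [RayleighFamily.position]
        omega
      have hrange : LinearMap.range ((S.H x).subtype ∘ₗ E.subtype) = S.eigenspace k x := by
        rw [LinearMap.range_comp, Submodule.range_subtype,
          RayleighFamily.map_kernel_eq_eigenspace hsp]
      rw [hpos, ← hrange]
      refine isMinMax_range _ (fun u v huv => Subtype.ext (Subtype.ext huv)) ?_
      have hmm := isMinMax_of_diagonalizing_basis e ((S.qForm x x).restrict E) (D.restrict E) hQe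
        (fun u v => hc.symmQ u v) (fun u hu => hc.posQ u (by simpa using hu))
        (fun u v => RayleighFamily.derivBilinForm_symm hD hN k h u v) hDe hmono j
      have himage : ∀ F : Submodule ℝ E,
          (fun u : E => S.rayleighx x (((S.H x).subtype ∘ₗ E.subtype) u) h) ''
            {u | u ∈ F ∧ u ≠ 0} =
          (fun u : E => (D.restrict E) u u / ((S.qForm x x).restrict E) u u) ''
            {u | u ∈ F ∧ u ≠ 0} := fun F => Set.image_congr fun u hu => hray u hu.2
      simp only [IsMinMax, himage]
      exact hmm
    · simpa using ((hasDerivAt_id (0 : ℝ)).smul_const h).const_add x
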